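/- **Setting.** For $n\ge 1$ write $[n]$ for a set of $n$ consecutive integers. A *resolvable $(v,k,r)$ tactical configuration with labelled resolution* is a nonempty incidence structure $D$ with a finite point set $\mathcal X$, $|\mathcal X|=v$, and a finite block index set $\mathcal R\times\mathcal A$, $|\mathcal R|=r$, $|\mathcal A|=a$, $b=ra$, with incidence relation $I$, such that every point is incident with exactly $r$ blocks, every block is incident with exactly $k$ points, and for all $x\in\mathcal X$, $i\in\mathcal R$ there is a unique $\gamma\in\mathcal A$ with $x\,I\,(i,\gamma)$ (the blocks $(i,\cdot)$ form a parallel class). A quasigroup on $\mathcal A$ is a map $L:\mathcal A\times\mathcal A\to\mathcal A$ such that $L(\alpha,\cdot)$ and $L(\cdot,\beta)$ are bijections for all $\alpha,\beta$. A *mosaic* on $(\mathcal X,\mathcal S)$ with color set $\mathcal A$ is a family $(D_\alpha)_{\alpha\in\mathcal A}$ of nonempty incidence structures on $(\mathcal X,\mathcal S)$ such that each pair $(x,s)$ is incident in exactly one $D_\alpha$; its *functional form* $f:\mathcal X\times\mathcal S\to\mathcal A$ maps $(x,s)$ to this $\alpha$. Two mosaics are isomorphic if they correspond under bijections of the point sets,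 the block index sets and the color sets. From $D$ and $L$ one obtains the mosaic $M=(D_\alpha)_{\alpha\in\mathcal A}$ on $(\mathcal X,\mathcal R\times\mathcal A)$, where $x$ and $(i,\beta)$ are incident in $D_\alpha$ if and only if $x\,I\,(i,\gamma)$ for the unique $\gamma$ with $L(\beta,\gamma)=\alpha$. Its dual $M^T=(D_\alpha^T)_{\alpha\in\mathcal A}$ is the mosaic on $(\mathcal R\times\mathcal A,\mathcal X)$ obtained by exchanging points and block indices in every member. **Complexity.** All objects are members of families indexed by an arbitrary set. A function attached to the members of a family is *computable in time* $\mathrm{poly}(\cdot)$ if one Turing machine computes it for all members within a number of steps bounded by one fixed polynomial in the indicated quantities. The machine receives the description of the member (a tuple of bit strings, on separate tapes), the integer parameters of the member ($a$ for a quasigroup; $v,b,k,r,a$ for a design or mosaic), and the arguments, all integers being written in binary. The description of the mosaics $M$ and $M^T$ consists of the description of $D$ together with that of $L$. Fix a bijection $\Phi:\mathcal A\to[a]$ (for every member). * $L$ is *explicit* if, for the quasigroup $\tilde L$ on $[a]$ with $\tilde L(\Phi(\beta),\Phi(\gamma))=\Phi(L(\beta,\gamma))$, (L1) $\tilde L(\tilde\beta,\tilde\gamma)$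 is computable in time $\mathrm{poly}(\log a)$, and (L2) the solution $\tilde\gamma$ of $\tilde L(\tilde\beta,\tilde\gamma)=\tilde\alpha$ is computable from $\tilde\beta,\tilde\alpha$ in time $\mathrm{poly}(\log a)$. $L$ is *explicit for duals* if (L1) holds and (L2)$^T$ the solution $\tilde\beta$ of $\tilde L(\tilde\beta,\tilde\gamma)=\tilde\alpha$ is computable from $\tilde\gamma,\tilde\alpha$ in time $\mathrm{poly}(\log a)$. * $D$ is *explicit* if there are an incidence structure $\tilde D=([v],[r]\times[a],\tilde I)$ and bijections $\Phi_{\mathcal X}:\mathcal X\to[v]$, $\Phi_{\mathcal R}:\mathcal R\to[r]$ with $x\,I\,(i,\gamma)\iff\Phi_{\mathcal X}(x)\,\tilde I\,(\Phi_{\mathcal R}(i),\Phi(\gamma))$ such that (D1) for $\tilde x\in[v]$, $\tilde\imath\in[r]$ the unique $\tilde\gamma$ with $\tilde x\,\tilde I\,(\tilde\imath,\tilde\gamma)$ is computable in time $\mathrm{poly}(\log v,\log r)$, and (D2) there is a map $g:[r]\times[a]\times[k]\to[v]$, computable in time $\mathrm{poly}(\log b,\log k)$, such that $g(\tilde\imath,\tilde\alpha,\cdot)$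 is a bijection from $[k]$ onto the set of points incident in $\tilde D$ with $(\tilde\imath,\tilde\alpha)$. The dual $D^T$ is *explicit* if there is such a $\tilde D$ satisfying (D1) and (D2)$^T$ there is a map $g^T:[v]\times[r]\to[r]\times[a]$, computable in time $\mathrm{poly}(\log b,\log k)$, such that $g^T(\tilde x,\cdot)$ is a bijection from $[r]$ onto the set of blocks incident in $\tilde D$ with $\tilde x$. * A mosaic with $v$ points, $b$ block indices, $a$ colors and $k$ points on each block of each member is *explicit* if it is isomorphic to a mosaic on $([v],[b])$ with color set $[a]$ whose functional form $\tilde f$ satisfies (M1) $\tilde f(\tilde x,\tilde s)$ is computable in time $\mathrm{poly}(\log v,\log b)$, and (M2) there is a map $g:[b]\times[a]\times[k]\to[v]$, computable in time $\mathrm{poly}(\log b,\log v)$, such that $g(\tilde s,\tilde\alpha,\cdot)$ is a bijection from $[k]$ onto $\{\tilde x:\tilde f(\tilde x,\tilde s)=\tilde\alpha\}$. For the dual mosaic $M^T$ the roles of $v,b$ and of $k,r$ are exchanged. **Theorem.** (1) If $D$ and $L$ are explicit (with respect to the same $\Phi$), then $M$ is explicit. (2) If $D^T$ is explicit and $L$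 is explicit for duals (with respect to the same $\Phi$), then $M^T$ is explicit. -/

import Mathlib

/-! ### Incidence structures and designs -/

/-- An incidence structure with points `X` and block indices `S`. -/
structure IncidenceStructure (X S : Type*) where
  /-- the incidence relation -/
  Inc : X → S → Prop

namespace IncidenceStructure

/-- The dual incidence structure: points and block indices are exchanged. -/
def dual {X S : Type*} (D : IncidenceStructure X S) : IncidenceStructure S X where
  Inc s x := D.Inc x s

/-- The incidence relation is not empty. -/
def IsNonempty {X S : Type*} (D : IncidenceStructure X S) : Prop :=
  ∃ x s, D.Inc x s

/-- A `(v, k, r)` tactical configuration: there are `v` points, every point is incident with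
precisely `r` block indices, and every block index is incident with precisely `k` points. -/
structure IsTactical {X S : Type*} (D : IncidenceStructure X S) (v k r : ℕ) : Prop where
  card_points : Nat.card X = v
  ncard_blocks : ∀ x, {s | D.Inc x s}.ncard = r
  ncard_points : ∀ s, {x | D.Inc x s}.ncard = k

/-- A labelled resolution: the block index set is `R × A`, where `R` indexes the parallel classes
and `A` indexes the blocks inside each parallel class. Every point is incident with exactly one
block of each parallel class. -/
def IsResolved {X R A : Type*} (D : IncidenceStructure X (R × A)) : Prop :=
  ∀ x i, ∃! γ, D.Inc x (i, γ)

/-- The labelled resolved structures `D` and `D'` are isomorphic, where the labels inside the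
parallel classes are translated by the bijection `e`. -/
def IsomorphicVia {X R A X' R' A' : Type*} (D : IncidenceStructure X (R × A))
    (D' : IncidenceStructure X' (R' × A')) (e : A ≃ A') : Prop :=
  ∃ (eX : X ≃ X') (eR : R ≃ R'),
    ∀ x i γ, D.Inc x (i, γ) ↔ D'.Inc (eX x) (eR i, e γ)

end IncidenceStructure

/-- The parameters of a design or of a mosaic of designs: the number `v` of points, the number `b`
of block indices, the number `k` of points on a block, the number `r` of blocks through a point, and
the number `a` of colors (for a resolved design: of blocks in a parallel class). -/
structure DesignParams where
  v : ℕ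
  b : ℕ
  k : ℕ
  r : ℕ
  a : ℕ

/-- The parameters of the dual. -/
def DesignParams.dual (P : DesignParams) : DesignParams where
  v := P.b
  b := P.v
  k := P.r
  r := P.k
  a := P.a

/-- `D` is a nonempty resolvable `(v, k, r)` tactical configuration with `b` blocks, which are
indexed by the `r` parallel classes and the `a` labels in each of them. -/
structure IncidenceStructure.IsResolvableConfig {X R A : Type*}
    (D : IncidenceStructure X (R × A)) (P : DesignParams) : Prop where
  tactical : D.IsTactical P.v P.k P.r
  resolved : D.IsResolved
  nonempty : D.IsNonempty
  card_classes : Nat.card R = P.r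
  card_labels : Nat.card A = P.a
  card_blocks : Nat.card (R × A) = P.b

/-! ### Quasigroups -/

/-- `L` is (the multiplication table of) a quasigroup. -/
structure IsQuasigroup {A : Type*} (L : A → A → A) : Prop where
  existsUnique_right : ∀ α γ, ∃! β, L α β = γ
  existsUnique_left : ∀ β γ, ∃! α, L α β = γ

/-! ### Mosaics -/

/-- A mosaic with color set `A`: a family of nonempty incidence structures on `(X, S)` such that
every pair `(x, s)` is incident in exactly one of them. -/
structure Mosaic (X S A : Type*) where
  /-- the members of the mosaic -/
  mem : A → IncidenceStructure X S
  nonempty : ∀ α, (mem α).IsNonempty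
  existsUnique_inc : ∀ x s, ∃! α, (mem α).Inc x s

namespace Mosaic

/-- The functional form of a mosaic: the color `α` for which `x` and `s` are incident in the member
of color `α`. -/
noncomputable def functionalForm {X S A : Type*} (M : Mosaic X S A) (x : X) (s : S) : A :=
  (M.existsUnique_inc x s).choose

theorem functionalForm_eq_iff {X S A : Type*} (M : Mosaic X S A) (x : X) (s : S) (α : A) :
    M.functionalForm x s = α ↔ (M.mem α).Inc x s := by
  constructor
  · rintro rfl
    exact (M.existsUnique_inc x s).choose_spec.1
  · intro h
    exact ((M.existsUnique_inc x s).choose_spec.2 α h).symm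

/-- The dual mosaic, formed by the duals of the members. -/
def dual {X S A : Type*} (M : Mosaic X S A) : Mosaic S X A where
  mem α := (M.mem α).dual
  nonempty α := by
    obtain ⟨x, s, h⟩ := M.nonempty α
    exact ⟨s, x, h⟩
  existsUnique_inc s x := M.existsUnique_inc x s

/-- Isomorphism of mosaics. -/
def Isomorphic {X S A X' S' A' : Type*} (M : Mosaic X S A) (M' : Mosaic X' S' A') : Prop :=
  ∃ (eX : X ≃ X') (eS : S ≃ S') (eA : A ≃ A'),
    ∀ x s α, (M.mem α).Inc x s ↔ (M'.mem (eA α)).Inc (eX x) (eS s)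

/-- The mosaic constructed from a resolved design `D` on `(X, R × A)` and a quasigroup `L` on `A`:
`x` and `(i, β)` are incident in the member of color `α` if and only if `x` and `(i, γ)` are
incident in `D` for the unique `γ` with `L β γ = α`. -/
def ofResolved {X R A : Type*} (D : IncidenceStructure X (R × A)) (hres : D.IsResolved)
    (hne : D.IsNonempty) (L : A → A → A) (hL : IsQuasigroup L) : Mosaic X (R × A) A where
  mem α := ⟨fun x s => ∃ γ, L s.2 γ = α ∧ D.Inc x (s.1, γ)⟩
  nonempty α := by
    obtain ⟨x, ⟨i, γ⟩, h⟩ := hne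
    obtain ⟨β, hβ, -⟩ := hL.existsUnique_left γ α
    exact ⟨x, (i, β), γ, hβ, h⟩
  existsUnique_inc x s := by
    obtain ⟨γ, hγ, hu⟩ := hres x s.1
    refine ⟨L s.2 γ, ⟨γ, rfl, hγ⟩, ?_⟩
    rintro α ⟨γ', rfl, h'⟩
    rw [hu γ' h']

end Mosaic

/-! ### Computations on Turing machines

The machines are multi-stack machines with Mathlib's `Turing.TM2` semantics, which are multitape
Turing machines (two stacks make up a tape) with constant overhead per step. One step executes the
program text of one label. -/

/-- A machine with `n` input stacks, `m` output stacks, finitely many work stacks, finitely many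
labels and finitely many internal states. All stacks carry bits. -/
structure StackMachine (n m : ℕ) where
  /-- number of work stacks -/
  w : ℕ
  /-- program labels -/
  Λ : Type
  /-- internal states -/
  σ : Type
  [finiteLabels : Finite Λ]
  [finiteStates : Finite σ]
  /-- the label at which the computation starts -/
  start : Λ
  /-- the initial internal state -/
  init : σ
  /-- the program -/
  prog : Λ → Turing.TM2.Stmt (fun _ : Fin n ⊕ Fin m ⊕ Fin w => Bool) Λ σ

/-- The initial configuration: the input strings are on the input stacks (first bit on top), all
other stacks are empty. -/
def StackMachine.initCfg {n m : ℕ} (M : StackMachine n m) (inp : Fin n → List Bool) :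
    Turing.TM2.Cfg (fun _ : Fin n ⊕ Fin m ⊕ Fin M.w => Bool) M.Λ M.σ where
  l := some M.start
  var := M.init
  stk := Sum.elim inp (fun _ => [])

/-- Started with `inp` on the input stacks, the machine halts after at most `T` steps and then the
output stacks hold `out`. -/
def StackMachine.OutputsWithin {n m : ℕ} (M : StackMachine n m) (inp : Fin n → List Bool)
    (out : Fin m → List Bool) (T : ℕ) : Prop :=
  ∃ c : Turing.TM2.Cfg (fun _ : Fin n ⊕ Fin m ⊕ Fin M.w => Bool) M.Λ M.σ,
    Nonempty (StateTransition.EvalsToInTime (Turing.TM2.step M.prog) (M.initCfg inp) (some c) T) ∧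
      c.l = none ∧ ∀ j, c.stk (Sum.inr (Sum.inl j)) = out j

/-- A single machine computes `out j` from `inp j` for all `j : J`, in time polynomial in
`size j`. -/
def ComputableInPolyTime {J : Type*} {n m : ℕ} (inp : J → Fin n → List Bool)
    (out : J → Fin m → List Bool) (size : J → ℕ) : Prop :=
  ∃ (M : StackMachine n m) (C c : ℕ),
    ∀ j, M.OutputsWithin (inp j) (out j) (C * (size j + 1) ^ c)

/-- The input of a machine: the description `name` of a member of a family, consisting of `d` bit
strings, followed by finitely many natural numbers in binary. -/
def machineInput {d n : ℕ} (name : Fin d → List Bool) (num : Fin n → ℕ) :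
    Fin (d + n) → List Bool :=
  Fin.append name (fun j => (num j).bits)

/-! ### Explicit families

In all definitions below, `i : ι` runs through the members of a family, and `name i` is the
description of member `i` which is handed to the machine. The set `Fin n` represents `[n]`. -/

/-- Explicitness of a family of mosaics with parameters `P`. -/
def Mosaic.ExplicitFamily {ι : Type*} {X S A : ι → Type*}
    (M : ∀ i, Mosaic (X i) (S i) (A i)) (P : ι → DesignParams)
    {d : ℕ} (name : ι → Fin d → List Bool) : Prop :=
  ∃ M' : ∀ i, Mosaic (Fin (P i).v) (Fin (P i).b) (Fin (P i).a),
    (∀ i, (M i).Isomorphic (M' i)) ∧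
    -- the functional form is computable in time `poly(log v, log b)`
    ComputableInPolyTime (J := Σ i, Fin (P i).v × Fin (P i).b)
      (fun ⟨i, x, s⟩ =>
        machineInput (name i) ![(P i).v, (P i).b, (P i).k, (P i).r, (P i).a, x, s])
      (fun ⟨i, x, s⟩ => ![((M' i).functionalForm x s : ℕ).bits])
      (fun ⟨i, _, _⟩ => Nat.log 2 (P i).v + Nat.log 2 (P i).b) ∧
    -- its preimages can be enumerated in time `poly(log b, log v)` per element
    ∃ g : ∀ i, Fin (P i).b → Fin (P i).a → Fin (P i).k → Fin (P i).v,
      (∀ i s α, Set.BijOn (g i s α) Set.univ {x | (M' i).functionalForm x s = α}) ∧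
      ComputableInPolyTime (J := Σ i, Fin (P i).b × Fin (P i).a × Fin (P i).k)
        (fun ⟨i, s, α, κ⟩ =>
          machineInput (name i) ![(P i).v, (P i).b, (P i).k, (P i).r, (P i).a, s, α, κ])
        (fun ⟨i, s, α, κ⟩ => ![(g i s α κ : ℕ).bits])
        (fun ⟨i, _, _, _⟩ => Nat.log 2 (P i).b + Nat.log 2 (P i).v)

/-- Given a point and a parallel class, the label of the block of that class which is incident with
the point is computable in time `poly(log v, log r)`. -/
def BlockLabelComputable {ι : Type*} (P : ι → DesignParams)
    (D : ∀ i, IncidenceStructure (Fin (P i).v) (Fin (P i).r × Fin (P i).a))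
    {d : ℕ} (name : ι → Fin d → List Bool) : Prop :=
  ∃ c : ∀ i, Fin (P i).v → Fin (P i).r → Fin (P i).a,
    (∀ i x j γ, (D i).Inc x (j, γ) ↔ γ = c i x j) ∧
    ComputableInPolyTime (J := Σ i, Fin (P i).v × Fin (P i).r)
      (fun ⟨i, x, j⟩ =>
        machineInput (name i) ![(P i).v, (P i).b, (P i).k, (P i).r, (P i).a, x, j])
      (fun ⟨i, x, j⟩ => ![(c i x j : ℕ).bits])
      (fun ⟨i, _, _⟩ => Nat.log 2 (P i).v + Nat.log 2 (P i).r)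

/-- The points incident with a given block can be enumerated in time `poly(log b, log k)` per
point. -/
def BlockPointsComputable {ι : Type*} (P : ι → DesignParams)
    (D : ∀ i, IncidenceStructure (Fin (P i).v) (Fin (P i).r × Fin (P i).a))
    {d : ℕ} (name : ι → Fin d → List Bool) : Prop :=
  ∃ g : ∀ i, Fin (P i).r → Fin (P i).a → Fin (P i).k → Fin (P i).v,
    (∀ i j α, Set.BijOn (g i j α) Set.univ {x | (D i).Inc x (j, α)}) ∧
    ComputableInPolyTime (J := Σ i, Fin (P i).r × Fin (P i).a × Fin (P i).k)
      (fun ⟨i, j, α, κ⟩ =>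
        machineInput (name i) ![(P i).v, (P i).b, (P i).k, (P i).r, (P i).a, j, α, κ])
      (fun ⟨i, j, α, κ⟩ => ![(g i j α κ : ℕ).bits])
      (fun ⟨i, _, _, _⟩ => Nat.log 2 (P i).b + Nat.log 2 (P i).k)

/-- The blocks incident with a given point can be enumerated in time `poly(log b, log k)` per
block. -/
def PointBlocksComputable {ι : Type*} (P : ι → DesignParams)
    (D : ∀ i, IncidenceStructure (Fin (P i).v) (Fin (P i).r × Fin (P i).a))
    {d : ℕ} (name : ι → Fin d → List Bool) : Prop :=
  ∃ g : ∀ i, Fin (P i).v → Fin (P i).r → Fin (P i).r × Fin (P i).a,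
    (∀ i x, Set.BijOn (g i x) Set.univ {s | (D i).Inc x s}) ∧
    ComputableInPolyTime (J := Σ i, Fin (P i).v × Fin (P i).r)
      (fun ⟨i, x, κ⟩ =>
        machineInput (name i) ![(P i).v, (P i).b, (P i).k, (P i).r, (P i).a, x, κ])
      (fun ⟨i, x, κ⟩ => ![((g i x κ).1 : ℕ).bits, ((g i x κ).2 : ℕ).bits])
      (fun ⟨i, _, _⟩ => Nat.log 2 (P i).b + Nat.log 2 (P i).k)

/-- Explicitness of a family of resolved designs, where the labels in the parallel classes are
identified with integers by the bijections `e i`. -/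
def IncidenceStructure.ExplicitFamily {ι : Type*} {X R A : ι → Type*}
    (D : ∀ i, IncidenceStructure (X i) (R i × A i)) (P : ι → DesignParams)
    (e : ∀ i, A i ≃ Fin (P i).a) {d : ℕ} (name : ι → Fin d → List Bool) : Prop :=
  ∃ D' : ∀ i, IncidenceStructure (Fin (P i).v) (Fin (P i).r × Fin (P i).a),
    (∀ i, (D i).IsomorphicVia (D' i) (e i)) ∧
    BlockLabelComputable P D' name ∧ BlockPointsComputable P D' name

/-- Explicitness of the duals of a family of resolved designs, where the labels in the parallel
classes are identified with integers by the bijections `e i`. -/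
def IncidenceStructure.DualExplicitFamily {ι : Type*} {X R A : ι → Type*}
    (D : ∀ i, IncidenceStructure (X i) (R i × A i)) (P : ι → DesignParams)
    (e : ∀ i, A i ≃ Fin (P i).a) {d : ℕ} (name : ι → Fin d → List Bool) : Prop :=
  ∃ D' : ∀ i, IncidenceStructure (Fin (P i).v) (Fin (P i).r × Fin (P i).a),
    (∀ i, (D i).IsomorphicVia (D' i) (e i)) ∧
    BlockLabelComputable P D' name ∧ PointBlocksComputable P D' name

/-- A binary function on `[a]` is computable in time `poly(log a)`. -/
def TableComputable {ι : Type*} (a : ι → ℕ) (F : ∀ i, Fin (a i) → Fin (a i) → Fin (a i))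
    {d : ℕ} (name : ι → Fin d → List Bool) : Prop :=
  ComputableInPolyTime (J := Σ i, Fin (a i) × Fin (a i))
    (fun ⟨i, β, γ⟩ => machineInput (name i) ![a i, β, γ])
    (fun ⟨i, β, γ⟩ => ![(F i β γ : ℕ).bits])
    (fun ⟨i, _, _⟩ => Nat.log 2 (a i))

/-- Explicitness of a family of quasigroups under the bijections `e i`: on the integers,
`L β γ` can be computed, and `L β · = α` can be solved. -/
def QuasigroupExplicitFamily {ι : Type*} {A : ι → Type*} (L : ∀ i, A i → A i → A i)
    (a : ι → ℕ) (e : ∀ i, A i ≃ Fin (a i)) {d : ℕ} (name : ι → Fin d → List Bool) : Prop :=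
  ∃ L' : ∀ i, Fin (a i) → Fin (a i) → Fin (a i),
    (∀ i β γ, L' i (e i β) (e i γ) = e i (L i β γ)) ∧
    TableComputable a L' name ∧
    ∃ sol : ∀ i, Fin (a i) → Fin (a i) → Fin (a i),
      (∀ i β α, L' i β (sol i β α) = α) ∧ TableComputable a sol name

/-- The version of explicitness of a family of quasigroups for dual mosaics: on the integers,
`L β γ` can be computed, and `L · γ = α` can be solved. -/
def QuasigroupDualExplicitFamily {ι : Type*} {A : ι → Type*} (L : ∀ i, A i → A i → A i)
    (a : ι → ℕ) (e : ∀ i, A i ≃ Fin (a i)) {d : ℕ} (name : ι → Fin d → List Bool) : Prop :=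
  ∃ L' : ∀ i, Fin (a i) → Fin (a i) → Fin (a i),
    (∀ i β γ, L' i (e i β) (e i γ) = e i (L i β γ)) ∧
    TableComputable a L' name ∧
    ∃ sol : ∀ i, Fin (a i) → Fin (a i) → Fin (a i),
      (∀ i γ α, L' i (sol i γ α) γ = α) ∧ TableComputable a sol name

/-! Let `c x i` be the label of the block of class `i` through `x`. Write a block index `s` of the
mosaic as `s = i * a + β`, so that `i = s / a` and `β = s % a`. On integers the functional form of
`M` is `L' β (c x i)`. For fixed `s` it takes the value `α` exactly if `c x i` is the unique
solution `γ` of `L' β γ = α`. The color class is therefore the block `(i, γ)` of the design, and the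
given enumeration of that block enumerates it (`bijOn_preimage`).

For the dual, fix `x` and `α`. The blocks through `x` are the pairs `(i, c x i)`, one for each
class. In class `i` exactly one `β` satisfies `L' β (c x i) = α`. Replacing the label `γ` by the
solution `β` of `L' β γ = α` in the list of blocks through `x` thus lists all `s` of color `α`
(`bijOn_dualPreimage`).

Each of these recipes composes the given machines with a division with remainder or with the map
`(i, β) ↦ i * a + β`. The time bounds fit together because `r` and `a` are at most `b = r * a`, and
`k ≤ v`.

Most of the work goes into showing that such compositions run in polynomial time on actual machines.
Programs are combined as flow charts (`stepsIn_flow`). Schoolbook arithmetic on binary digits gives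
`runs_divMod` and `runs_mulAdd`, and `PolyComp.comp` composes two polynomial-time programs. The
descriptions of `D` and `L` may be arbitrarily long compared with the time bound, so they cannot be
copied. This does no harm: every composite calls one machine for `D` and one for `L`, and each works
directly on its own description. Only numbers are copied, at a cost proportional to their number of
digits. -/

/-! ### Stack programs and their combinators -/

/-- A program for a machine with the set `K` of stacks, all of which carry bits. -/
structure StackProg (K : Type) where
  /-- program labels -/
  Λ : Type
  /-- internal states -/
  σ : Type
  [finiteLabels : Finite Λ]
  [finiteStates : Finite σ]
  /-- the label at which the computation starts -/
  start : Λ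
  /-- the initial internal state -/
  init : σ
  /-- the program -/
  prog : Λ → Turing.TM2.Stmt (fun _ : K => Bool) Λ σ

attribute [instance] StackProg.finiteLabels StackProg.finiteStates

/-- `StepsIn f n a b`: iterating the partial function `f` leads from `a` to `b` in `n` steps. -/
inductive StepsIn {α : Type*} (f : α → Option α) : ℕ → α → α → Prop
  | refl (a : α) : StepsIn f 0 a a
  | head {a b c : α} {n : ℕ} : f a = some b → StepsIn f n b c → StepsIn f (n + 1) a c

theorem StepsIn.trans {α : Type*} {f : α → Option α} {m n : ℕ} {a b c : α}
    (h₁ : StepsIn f m a b) (h₂ : StepsIn f n b c) : StepsIn f (m + n) a c := by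
  induction h₁ with
  | refl a => simpa using h₂
  | head h _ ih =>
    rw [Nat.add_right_comm]
    exact .head h (ih h₂)

/-- This and `stepsIn_of_iterate` translate between `StepsIn` and the iterates by which
`StateTransition.EvalsToInTime` counts steps. -/
theorem StepsIn.iterate {α : Type*} {f : α → Option α} {n : ℕ} {a b : α}
    (h : StepsIn f n a b) : (flip bind f)^[n] (some a) = some b := by
  induction h with
  | refl a => rfl
  | head h _ ih =>
    rw [Function.iterate_succ_apply]
    simpa [flip, h] using ih

theorem stepsIn_of_iterate {α : Type*} {f : α → Option α} {n : ℕ} {a b : α}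
    (h : (flip bind f)^[n] (some a) = some b) : StepsIn f n a b := by
  induction n generalizing a with
  | zero =>
    obtain rfl : a = b := by simpa using h
    exact .refl a
  | succ n ih =>
    rw [Function.iterate_succ_apply] at h
    cases hf : f a with
    | none =>
      have hn : ∀ m, (flip bind f)^[m] none = none := fun m => by
        induction m with
        | zero => rfl
        | succ m ihm =>
          rw [Function.iterate_succ_apply]
          exact ihm
      have h' : (flip bind f)^[n] (f a) = some b := h
      rw [hf, hn] at h'
      cases h'
    | some c =>
      refine .head hf (ih ?_)
      simpa [flip, hf] using h

/-- Translation of statements along maps of the stacks, the states and the labels. Instead of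
halting, the translated statement continues with `q`. -/
def liftStmt {K₁ K Λ₁ Λ σ₁ σ : Type} (f : K₁ → K) (emb : σ₁ → σ) (ret : σ → σ₁) (g : Λ₁ → Λ)
    (q : Turing.TM2.Stmt (fun _ : K => Bool) Λ σ) :
    Turing.TM2.Stmt (fun _ : K₁ => Bool) Λ₁ σ₁ → Turing.TM2.Stmt (fun _ : K => Bool) Λ σ
  | .push k h s => .push (f k) (fun v => h (ret v)) (liftStmt f emb ret g q s)
  | .peek k h s => .peek (f k) (fun v o => emb (h (ret v) o)) (liftStmt f emb ret g q s)
  | .pop k h s => .pop (f k) (fun v o => emb (h (ret v) o)) (liftStmt f emb ret g q s)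
  | .load h s => .load (fun v => emb (h (ret v))) (liftStmt f emb ret g q s)
  | .branch h s₁ s₂ =>
    .branch (fun v => h (ret v)) (liftStmt f emb ret g q s₁) (liftStmt f emb ret g q s₂)
  | .goto h => .goto (fun v => g (h (ret v)))
  | .halt => q

theorem extend_update {K₁ K α : Type*} [DecidableEq K₁] [DecidableEq K] {f : K₁ → K}
    (hf : f.Injective) (T : K₁ → α) (S : K → α) (k : K₁) (x : α) :
    Function.update (Function.extend f T S) (f k) x =
      Function.extend f (Function.update T k x) S := by
  ext j
  by_cases hj : ∃ i, f i = j
  · obtain ⟨i, rfl⟩ := hj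
    rw [hf.extend_apply]
    by_cases hik : i = k
    · subst hik; simp
    · rw [Function.update_of_ne (hf.ne hik), Function.update_of_ne hik, hf.extend_apply]
  · rw [Function.extend_apply' _ _ _ hj, Function.update_of_ne, Function.extend_apply' _ _ _ hj]
    rintro rfl
    exact hj ⟨k, rfl⟩

/-- The small program sees only the stacks in the image of `f`, and its state stays in the image of
`emb`, where `ret` recovers it. The remaining stacks `S` are untouched until `q` takes over. -/
theorem stepAux_liftStmt {K₁ K Λ₁ Λ σ₁ σ : Type} [DecidableEq K₁] [DecidableEq K]
    {f : K₁ → K} (hf : f.Injective) {emb : σ₁ → σ} {ret : σ → σ₁} (hr : ∀ v, ret (emb v) = v)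
    (g : Λ₁ → Λ) (q : Turing.TM2.Stmt (fun _ : K => Bool) Λ σ) (S : K → List Bool)
    (s : Turing.TM2.Stmt (fun _ : K₁ => Bool) Λ₁ σ₁) (v : σ₁) (T : K₁ → List Bool) :
    Turing.TM2.stepAux (liftStmt f emb ret g q s) (emb v) (Function.extend f T S) =
      let c := Turing.TM2.stepAux s v T
      match c.l with
      | some l => ⟨some (g l), emb c.var, Function.extend f c.stk S⟩
      | none => Turing.TM2.stepAux q (emb c.var) (Function.extend f c.stk S) := by
  induction s generalizing v T with
  | push k h s ih =>
    simp only [liftStmt, Turing.TM2.stepAux, hr, hf.extend_apply, extend_update hf, ih]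
  | peek k h s ih =>
    simp only [liftStmt, Turing.TM2.stepAux, hr, hf.extend_apply, ih]
  | pop k h s ih =>
    simp only [liftStmt, Turing.TM2.stepAux, hr, hf.extend_apply, extend_update hf, ih]
  | load h s ih =>
    simp only [liftStmt, Turing.TM2.stepAux, hr, ih]
  | branch h s₁ s₂ ih₁ ih₂ =>
    simp only [liftStmt, Turing.TM2.stepAux, hr]
    cases h v
    · simpa using ih₂ v T
    · simpa using ih₁ v T
  | goto h => simp only [liftStmt, Turing.TM2.stepAux, hr]
  | halt => simp only [liftStmt, Turing.TM2.stepAux]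

/-- The continuation `q` is executed within the very step in which the small program would halt.
Hence the number of steps does not change. -/
theorem stepsIn_liftStmt {K₁ K Λ₁ Λ σ₁ σ : Type} [DecidableEq K₁] [DecidableEq K]
    {f : K₁ → K} (hf : f.Injective) {emb : σ₁ → σ} {ret : σ → σ₁} (hr : ∀ v, ret (emb v) = v)
    {g : Λ₁ → Λ} {q : Turing.TM2.Stmt (fun _ : K => Bool) Λ σ} (S : K → List Bool)
    {p₁ : Λ₁ → Turing.TM2.Stmt (fun _ : K₁ => Bool) Λ₁ σ₁}
    {p : Λ → Turing.TM2.Stmt (fun _ : K => Bool) Λ σ}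
    (hp : ∀ l, p (g l) = liftStmt f emb ret g q (p₁ l)) {n : ℕ} {l : Λ₁} {v v' : σ₁}
    {T T' : K₁ → List Bool}
    (h : StepsIn (Turing.TM2.step p₁) n ⟨some l, v, T⟩ ⟨none, v', T'⟩) :
    StepsIn (Turing.TM2.step p) n ⟨some (g l), emb v, Function.extend f T S⟩
      (Turing.TM2.stepAux q (emb v') (Function.extend f T' S)) := by
  induction n generalizing l v T with
  | zero => cases h
  | succ n ih =>
    cases h with
    | head h₁ h₂ =>
      rename_i c
      rw [Turing.TM2.step, Option.some.injEq] at h₁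
      have hstep := stepAux_liftStmt hf hr g q S (p₁ l) v T
      rw [h₁] at hstep
      obtain ⟨_ | l', w, U⟩ := c
      · cases h₂ with
        | refl =>
          refine .head ?_ (.refl _)
          rw [Turing.TM2.step, hp, hstep]
        | head h₃ _ => simp [Turing.TM2.step] at h₃
      · refine .head ?_ (ih h₂)
        rw [Turing.TM2.step, hp, hstep]

/-! ### Runs of programs, and flow charts. -/

namespace StackProg

/-- Started on the stacks `S`, the program halts after at most `T` steps, leaving the stacks
`S'`. -/
def Runs {K : Type} [DecidableEq K] (P : StackProg K) (S S' : K → List Bool) (T : ℕ) : Prop :=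
  ∃ n ≤ T, ∃ v, StepsIn (Turing.TM2.step P.prog) n ⟨some P.start, P.init, S⟩ ⟨none, v, S'⟩

theorem Runs.mono {K : Type} [DecidableEq K] {P : StackProg K} {S S' : K → List Bool} {T T' : ℕ}
    (h : P.Runs S S' T) (hT : T ≤ T') : P.Runs S S' T' := by
  obtain ⟨n, hn, v, h⟩ := h
  exact ⟨n, hn.trans hT, v, h⟩

theorem Runs.to {K : Type} [DecidableEq K] {P : StackProg K} {S S' S'' : K → List Bool}
    {T T' : ℕ} (h : P.Runs S S' T) (hS : S' = S'') (hT : T ≤ T') : P.Runs S S'' T' :=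
  hS ▸ h.mono hT

/-- The program `P` on the image of its stacks under `f`. -/
def mapStacks {K₁ K : Type} (P : StackProg K₁) (f : K₁ → K) : StackProg K where
  Λ := P.Λ
  σ := P.σ
  start := P.start
  init := P.init
  prog l := liftStmt f id id id .halt (P.prog l)

theorem Runs.mapStacks {K₁ K : Type} [DecidableEq K₁] [DecidableEq K] {P : StackProg K₁}
    {f : K₁ → K} (hf : f.Injective) {S : K → List Bool} {T' : K₁ → List Bool} {t : ℕ}
    (h : P.Runs (S ∘ f) T' t) : (P.mapStacks f).Runs S (Function.extend f T' S) t := by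
  obtain ⟨n, hn, v, h⟩ := h
  refine ⟨n, hn, v, ?_⟩
  have hS : Function.extend f (S ∘ f) S = S := by
    ext1 j
    by_cases hj : ∃ i, f i = j
    · obtain ⟨i, rfl⟩ := hj
      rw [hf.extend_apply, Function.comp_apply]
    · rw [Function.extend_apply' _ _ _ hj]
  have := stepsIn_liftStmt hf (emb := id) (ret := id) (fun _ => rfl) (g := id) (q := .halt) S
    (p := (P.mapStacks f).prog) (fun l => rfl) h
  rwa [hS] at this

/-- The program which halts immediately. -/
def skip (K : Type) : StackProg K where
  Λ := Unit
  σ := Unit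
  start := ()
  init := ()
  prog _ := .halt

/-- The program which pushes a bit. -/
def push {K : Type} (k : K) (b : Bool) : StackProg K where
  Λ := Unit
  σ := Unit
  start := ()
  init := ()
  prog _ := .push k (fun _ => b) .halt

theorem runs_skip {K : Type} [DecidableEq K] (S : K → List Bool) : (skip K).Runs S S 1 :=
  ⟨1, le_rfl, (), .head rfl (.refl _)⟩

theorem runs_push {K : Type} [DecidableEq K] (k : K) (b : Bool) (S : K → List Bool) :
    (push k b).Runs S (Function.update S k (b :: S k)) 1 :=
  ⟨1, le_rfl, (), .head rfl (.refl _)⟩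

/-- The statement that pops from a stack if one is indicated. -/
def popStmt {K Λ σ : Type} (k : Option K) (h : Option Bool → σ)
    (q : Turing.TM2.Stmt (fun _ : K => Bool) Λ σ) : Turing.TM2.Stmt (fun _ : K => Bool) Λ σ :=
  match k with
  | none => .load (fun _ => h none) q
  | some k => .pop k (fun _ o => h o) q

/-- The bit which `popStmt` reads. -/
def popBit {K : Type} (k : Option K) (S : K → List Bool) : Option Bool :=
  k.bind fun k => (S k).head?

/-- The stacks which `popStmt` leaves. -/
def popStacks {K : Type} [DecidableEq K] (k : Option K) (S : K → List Bool) : K → List Bool :=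
  match k with
  | none => S
  | some k => Function.update S k (S k).tail

theorem stepAux_popStmt {K Λ σ : Type} [DecidableEq K] (k : Option K) (h : Option Bool → σ)
    (q : Turing.TM2.Stmt (fun _ : K => Bool) Λ σ) (v : σ) (S : K → List Bool) :
    Turing.TM2.stepAux (popStmt k h q) v S =
      Turing.TM2.stepAux q (h (popBit k S)) (popStacks k S) := by
  cases k <;> rfl

open Classical in
/-- The internal state at the node `n` of a flow chart. -/
noncomputable def nodeState {K N : Type} (P : N → StackProg K) (n : N) :
    Option (Σ n, (P n).σ) → (P n).σ
  | none => (P n).init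
  | some w => if h : w.1 = n then h ▸ w.2 else (P n).init

/-- The transition to the next node of a flow chart. -/
def flowExit {K N : Type} (P : N → StackProg K) (k : N → Option K)
    (next : N → Option Bool → Option N) (n₀ n : N) :
    Turing.TM2.Stmt (fun _ : K => Bool) (Σ n, (P n).Λ) (Option (Σ n, (P n).σ)) :=
  popStmt (k n) (fun o => (next n o).map fun n => ⟨n, (P n).init⟩)
    (.branch Option.isSome
      -- The bit read is remembered only through the next node stored in the state. The default
      -- value is never used, since the branch has tested `isSome`.
      (.goto fun v => (v.map fun w => (⟨w.1, (P w.1).start⟩ : Σ n, (P n).Λ)).getD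
        ⟨n₀, (P n₀).start⟩) .halt)

/-- The statements of a flow chart. -/
noncomputable def flowProg {K N : Type} (P : N → StackProg K) (k : N → Option K)
    (next : N → Option Bool → Option N) (n₀ : N) (l : Σ n, (P n).Λ) :
    Turing.TM2.Stmt (fun _ : K => Bool) (Σ n, (P n).Λ) (Option (Σ n, (P n).σ)) :=
  liftStmt id (fun v => some ⟨l.1, v⟩) (nodeState P l.1) (Sigma.mk l.1)
    (flowExit P k next n₀ l.1) ((P l.1).prog l.2)

/-- A flow chart, whose nodes `n` are programs `P n`. When `P n` has halted, a bit is popped from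
the stack `k n` if there is one, and the node `next n o` is entered, where `o` is the bit read. -/
noncomputable def flow {K N : Type} [Finite N] (P : N → StackProg K) (k : N → Option K)
    (next : N → Option Bool → Option N) (n₀ : N) : StackProg K where
  Λ := Σ n, (P n).Λ
  σ := Option (Σ n, (P n).σ)
  start := ⟨n₀, (P n₀).start⟩
  init := some ⟨n₀, (P n₀).init⟩
  prog := flowProg P k next n₀

/-- Leaving a node takes no extra step, because `flowExit` replaces the halting statement. The next
node starts in its own initial state. -/
theorem stepsIn_flow {K N : Type} [DecidableEq K] {P : N → StackProg K}
    {k : N → Option K} {next : N → Option Bool → Option N} (n₀ : N) {n : N}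
    {S S' : K → List Bool} {t : ℕ} (h : (P n).Runs S S' t) :
    ∃ m ≤ t, StepsIn (Turing.TM2.step (flowProg P k next n₀)) m
      ⟨some ⟨n, (P n).start⟩, some ⟨n, (P n).init⟩, S⟩
      (match next n (popBit (k n) S') with
      | none => ⟨none, none, popStacks (k n) S'⟩
      | some n' => ⟨some ⟨n', (P n').start⟩, some ⟨n', (P n').init⟩, popStacks (k n) S'⟩) := by
  obtain ⟨m, hm, v, h⟩ := h
  refine ⟨m, hm, ?_⟩
  have := stepsIn_liftStmt Function.injective_id (emb := fun v => some ⟨n, v⟩)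
    (ret := nodeState P n) (by intro v; simp [nodeState]) (g := Sigma.mk n)
    (q := flowExit P k next n₀ n) S (p := flowProg P k next n₀) (fun l => rfl) h
  have hid : ∀ T : K → List Bool, Function.extend id T S = T := fun T => by
    ext1 j; exact Function.injective_id.extend_apply T S j
  rw [hid, hid, flowExit, stepAux_popStmt] at this
  cases hn : next n (popBit (k n) S') <;> rw [hn] at this <;> exact this

/-- The runs of a flow chart which is entered at a node. -/
inductive FlowRuns {K N : Type} [DecidableEq K] (P : N → StackProg K) (k : N → Option K)
    (next : N → Option Bool → Option N) : N → (K → List Bool) → (K → List Bool) → ℕ → Prop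
  | last {n : N} {S S' : K → List Bool} {t : ℕ} : (P n).Runs S S' t →
      next n (popBit (k n) S') = none → FlowRuns P k next n S (popStacks (k n) S') t
  | step {n n' : N} {S S' S'' : K → List Bool} {t t' : ℕ} : (P n).Runs S S' t →
      next n (popBit (k n) S') = some n' → FlowRuns P k next n' (popStacks (k n) S') S'' t' →
      FlowRuns P k next n S S'' (t + t')

theorem FlowRuns.stepsIn {K N : Type} [DecidableEq K] {P : N → StackProg K}
    {k : N → Option K} {next : N → Option Bool → Option N} {n : N} {S S' : K → List Bool} {t : ℕ}
    (h : FlowRuns P k next n S S' t) (n₀ : N) :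
    ∃ m ≤ t, ∃ v, StepsIn (Turing.TM2.step (flowProg P k next n₀)) m
      ⟨some ⟨n, (P n).start⟩, some ⟨n, (P n).init⟩, S⟩ ⟨none, v, S'⟩ := by
  induction h with
  | last h₁ h₂ =>
    obtain ⟨m, hm, h₁⟩ := stepsIn_flow (k := k) (next := next) n₀ h₁
    rw [h₂] at h₁
    exact ⟨m, hm, _, h₁⟩
  | step h₁ h₂ _ ih =>
    obtain ⟨m, hm, h₁⟩ := stepsIn_flow (k := k) (next := next) n₀ h₁
    obtain ⟨m', hm', v', ih⟩ := ih
    rw [h₂] at h₁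
    exact ⟨m + m', add_le_add hm hm', v', h₁.trans ih⟩

theorem runs_flow {K N : Type} [Finite N] [DecidableEq K] {P : N → StackProg K}
    {k : N → Option K} {next : N → Option Bool → Option N} {n : N} {S S' : K → List Bool} {t : ℕ}
    (h : FlowRuns P k next n S S' t) : (flow P k next n).Runs S S' t := h.stepsIn n

/-- Sequential composition. -/
noncomputable def seq {K : Type} (P Q : StackProg K) : StackProg K :=
  flow (fun n : Bool => if n then Q else P) (fun _ => none)
    (fun n _ => if n then none else some true) false

theorem Runs.seq {K : Type} [DecidableEq K] {P Q : StackProg K} {S S' S'' : K → List Bool}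
    {t t' : ℕ} (h₁ : P.Runs S S' t) (h₂ : Q.Runs S' S'' t') : (P.seq Q).Runs S S'' (t + t') :=
  runs_flow (.step (n := false) h₁ rfl (.last (n := true) h₂ rfl))

/-- Pop the top bit of the stack `k` and continue with a program that depends on it. -/
noncomputable def popCase {K : Type} (k : K) (P : Option Bool → StackProg K) : StackProg K :=
  flow (fun n : Option (Option Bool) => n.elim (skip K) P)
    (fun n => n.elim (some k) fun _ => none) (fun n o => n.elim (some (some o)) fun _ => none) none

theorem Runs.popCase {K : Type} [DecidableEq K] {k : K} {P : Option Bool → StackProg K}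
    {S S' : K → List Bool} {t : ℕ}
    (h : (P (S k).head?).Runs (Function.update S k (S k).tail) S' t) :
    (popCase k P).Runs S S' (1 + t) :=
  runs_flow (.step (n := none) (runs_skip S) rfl (.last (n := some (S k).head?) h rfl))

/-- Pop the bits of the stack `k` one by one, running a program that depends on the bit each time,
until the stack is empty. -/
noncomputable def loop {K : Type} (k : K) (P : Bool → StackProg K) : StackProg K :=
  flow (fun n : Option Bool => n.elim (skip K) P)
    (fun n => n.elim (some k) fun _ => none) (fun n o => n.elim (o.map some) fun _ => some none) none

theorem runs_loop_nil {K : Type} [DecidableEq K] {k : K} (P : Bool → StackProg K)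
    {S : K → List Bool} (h : S k = []) : (loop k P).Runs S S 1 := by
  have : popStacks (some k) S = S := by simp [popStacks, h]
  refine runs_flow ?_
  have h' := FlowRuns.last (P := fun n : Option Bool => n.elim (skip K) P)
    (k := fun n => n.elim (some k) fun _ => none)
    (next := fun n o => n.elim (o.map some) fun _ => some none) (n := none) (runs_skip S)
    (by simp [popBit, h])
  simpa [this] using h'

/-- One round leads from the head of the loop through the body back to the head, where the assumed
run of the whole loop can be appended. The summand `1` is the step of `skip` at the head. -/
theorem runs_loop_cons {K : Type} [DecidableEq K] {k : K} {P : Bool → StackProg K}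
    {S S' S'' : K → List Bool} {b : Bool} {l : List Bool} {t t' : ℕ} (h : S k = b :: l)
    (h₁ : (P b).Runs (Function.update S k l) S' t) (h₂ : (loop k P).Runs S' S'' t') :
    (loop k P).Runs S S'' (1 + t + t') := by
  obtain ⟨m₀, hm₀, h₀⟩ := stepsIn_flow (P := fun n : Option Bool => n.elim (skip K) P)
    (k := fun n => n.elim (some k) fun _ => none)
    (next := fun n o => n.elim (o.map some) fun _ => some none) none (n := none) (runs_skip S)
  obtain ⟨m₁, hm₁, h₁⟩ := stepsIn_flow (P := fun n : Option Bool => n.elim (skip K) P)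
    (k := fun n => n.elim (some k) fun _ => none)
    (next := fun n o => n.elim (o.map some) fun _ => some none) none (n := some b) h₁
  obtain ⟨m₂, hm₂, v, h₂⟩ := h₂
  have hk : popBit (some k) S = some b := by simp [popBit, h]
  have hS : popStacks (some k) S = Function.update S k l := by simp [popStacks, h]
  simp only [Option.elim_none, hk, hS, Option.map_some] at h₀
  exact ⟨m₀ + m₁ + m₂, by omega, v, (h₀.trans h₁).trans h₂⟩

end StackProg

/-! ### Binary arithmetic on stacks -/

/-- The number with the given binary digits, least significant digit first. -/
def bitsVal (l : List Bool) : ℕ := l.foldr Nat.bit 0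

@[simp] theorem bitsVal_nil : bitsVal [] = 0 := rfl

@[simp] theorem bitsVal_cons (b : Bool) (l : List Bool) :
    bitsVal (b :: l) = 2 * bitsVal l + b.toNat := by
  simp [bitsVal, Nat.bit_val]

theorem bitsVal_lt (l : List Bool) : bitsVal l < 2 ^ l.length := by
  induction l with
  | nil => simp
  | cons b l ih =>
    rw [bitsVal_cons, List.length_cons, pow_succ]
    cases b <;> simp <;> omega

/-- The exception is the one case in which a new lowest digit would be a leading zero. -/
theorem bits_bit (b : Bool) (n : ℕ) :
    (2 * n + b.toNat).bits = if n = 0 ∧ b = false then [] else b :: n.bits := by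
  split_ifs with h
  · simp [h]
  · rw [← Nat.bit_val, Nat.bits_append_bit]
    intro hn
    by_contra hb
    exact h ⟨hn, by simpa using hb⟩

@[simp] theorem bitsVal_bits (n : ℕ) : bitsVal n.bits = n := by
  induction n using Nat.strong_induction_on with
  | _ n ih =>
    rcases Nat.eq_zero_or_pos n with rfl | hn
    · simp
    · obtain ⟨b, m, rfl⟩ : ∃ b : Bool, ∃ m, n = 2 * m + b.toNat :=
        ⟨n.bodd, n.div2, by rw [← Nat.bit_val, Nat.bit_bodd_div2]⟩
      rw [bits_bit, if_neg]
      · rw [bitsVal_cons, ih m]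
        cases b <;> simp at hn ⊢ <;> omega
      · rintro ⟨rfl, rfl⟩
        simp at hn

theorem length_bits_le (n : ℕ) : n.bits.length ≤ Nat.log 2 n + 1 := by
  rw [Nat.size_eq_bits_len, Nat.size_le]
  exact Nat.lt_pow_succ_log_self (by norm_num) n

/-! ### Elementary operations on stacks. -/

namespace StackProg

/-- Pour the stack `k` onto the stack `k'`. -/
noncomputable def move {K : Type} (k k' : K) : StackProg K := loop k (push k')

theorem runs_move {K : Type} [DecidableEq K] {k k' : K} (hk : k ≠ k') (S : K → List Bool) :
    (move k k').Runs S (Function.update (Function.update S k []) k' ((S k).reverse ++ S k'))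
      (2 * (S k).length + 1) := by
  generalize hl : S k = l
  induction l generalizing S with
  | nil =>
    refine (runs_loop_nil (push k') hl).to ?_ le_rfl
    rw [← hl, Function.update_eq_self, hl]
    simp
  | cons b l ih =>
    have h₁ := runs_push k' b (Function.update S k l)
    have h₂ := ih (Function.update (Function.update S k l) k' (b :: S k')) (by simp [hk])
    rw [Function.update_of_ne hk.symm] at h₁
    refine (runs_loop_cons hl h₁ h₂).to ?_ (by simp; omega)
    ext1 j
    by_cases hj : j = k'
    · subst hj; simp
    · by_cases hj' : j = k
      · subst hj'; simp [hj]
      · simp [hj, hj']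

/-- Empty the stack `k`. -/
noncomputable def clear {K : Type} (k : K) : StackProg K := loop k fun _ => skip K

theorem runs_clear {K : Type} [DecidableEq K] (k : K) (S : K → List Bool) :
    (clear k).Runs S (Function.update S k []) (2 * (S k).length + 1) := by
  generalize hl : S k = l
  induction l generalizing S with
  | nil =>
    exact (runs_loop_nil (fun _ => skip K) hl).to (by rw [← hl, Function.update_eq_self]) le_rfl
  | cons b l ih =>
    have h := runs_loop_cons hl (runs_skip _) (ih (Function.update S k l) (by simp))
    rw [Function.update_idem] at h
    exact h.mono (by simp; omega)

/-- Push a bit onto a stack that holds the binary expansion of a number, leaving no leading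
zero. -/
noncomputable def pushBit {K : Type} (k : K) (b : Bool) : StackProg K :=
  popCase k fun o => o.elim (if b then push k true else skip K) fun c => (push k c).seq (push k b)

/-- A number is zero exactly if its stack is empty, so a single pop detects the exceptional case of
`bits_bit`. If a digit was popped, it is put back before `b` is pushed. -/
theorem runs_pushBit {K : Type} [DecidableEq K] (k : K) (b : Bool) {S : K → List Bool} {n : ℕ}
    (hS : S k = n.bits) :
    (pushBit k b).Runs S (Function.update S k (2 * n + b.toNat).bits) 3 := by
  refine Runs.popCase (t := 2) ?_
  rw [bits_bit]
  rcases Nat.eq_zero_or_pos n with rfl | hn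
  · have h0 : S k = [] := by simpa using hS
    cases b
    · simpa [h0] using (runs_skip (Function.update S k [])).mono one_le_two
    · simpa [h0] using (runs_push k true (Function.update S k [])).mono one_le_two
  · rw [if_neg (show ¬(n = 0 ∧ b = false) from fun h => hn.ne' h.1)]
    cases hl : n.bits with
    | nil =>
      have := bitsVal_bits n
      rw [hl] at this
      simp at this
      omega
    | cons c l =>
      have := (runs_push k c (Function.update S k l)).seq (runs_push k b _)
      simpa [hS, hl, hn.ne'] using this

/-! #### The register machine for division and multiplication -/

/-- The contents of nine stacks. -/
def regs (l₀ l₁ l₂ l₃ l₄ l₅ l₆ l₇ l₈ : List Bool) : Fin 9 → List Bool :=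
  ![l₀, l₁, l₂, l₃, l₄, l₅, l₆, l₇, l₈]

theorem regs_apply (l₀ l₁ l₂ l₃ l₄ l₅ l₆ l₇ l₈ : List Bool) :
    regs l₀ l₁ l₂ l₃ l₄ l₅ l₆ l₇ l₈ 0 = l₀ ∧ regs l₀ l₁ l₂ l₃ l₄ l₅ l₆ l₇ l₈ 1 = l₁ ∧
    regs l₀ l₁ l₂ l₃ l₄ l₅ l₆ l₇ l₈ 2 = l₂ ∧ regs l₀ l₁ l₂ l₃ l₄ l₅ l₆ l₇ l₈ 3 = l₃ ∧
    regs l₀ l₁ l₂ l₃ l₄ l₅ l₆ l₇ l₈ 4 = l₄ ∧ regs l₀ l₁ l₂ l₃ l₄ l₅ l₆ l₇ l₈ 5 = l₅ ∧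
    regs l₀ l₁ l₂ l₃ l₄ l₅ l₆ l₇ l₈ 6 = l₆ ∧ regs l₀ l₁ l₂ l₃ l₄ l₅ l₆ l₇ l₈ 7 = l₇ ∧
    regs l₀ l₁ l₂ l₃ l₄ l₅ l₆ l₇ l₈ 8 = l₈ :=
  ⟨rfl, rfl, rfl, rfl, rfl, rfl, rfl, rfl, rfl⟩

theorem regs_update (l₀ l₁ l₂ l₃ l₄ l₅ l₆ l₇ l₈ l : List Bool) :
    Function.update (regs l₀ l₁ l₂ l₃ l₄ l₅ l₆ l₇ l₈) 0 l = regs l l₁ l₂ l₃ l₄ l₅ l₆ l₇ l₈ ∧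
    Function.update (regs l₀ l₁ l₂ l₃ l₄ l₅ l₆ l₇ l₈) 1 l = regs l₀ l l₂ l₃ l₄ l₅ l₆ l₇ l₈ ∧
    Function.update (regs l₀ l₁ l₂ l₃ l₄ l₅ l₆ l₇ l₈) 2 l = regs l₀ l₁ l l₃ l₄ l₅ l₆ l₇ l₈ ∧
    Function.update (regs l₀ l₁ l₂ l₃ l₄ l₅ l₆ l₇ l₈) 3 l = regs l₀ l₁ l₂ l l₄ l₅ l₆ l₇ l₈ ∧
    Function.update (regs l₀ l₁ l₂ l₃ l₄ l₅ l₆ l₇ l₈) 4 l = regs l₀ l₁ l₂ l₃ l l₅ l₆ l₇ l₈ ∧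
    Function.update (regs l₀ l₁ l₂ l₃ l₄ l₅ l₆ l₇ l₈) 5 l = regs l₀ l₁ l₂ l₃ l₄ l l₆ l₇ l₈ ∧
    Function.update (regs l₀ l₁ l₂ l₃ l₄ l₅ l₆ l₇ l₈) 6 l = regs l₀ l₁ l₂ l₃ l₄ l₅ l l₇ l₈ ∧
    Function.update (regs l₀ l₁ l₂ l₃ l₄ l₅ l₆ l₇ l₈) 7 l = regs l₀ l₁ l₂ l₃ l₄ l₅ l₆ l l₈ ∧
    Function.update (regs l₀ l₁ l₂ l₃ l₄ l₅ l₆ l₇ l₈) 8 l = regs l₀ l₁ l₂ l₃ l₄ l₅ l₆ l₇ l := by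
  refine ⟨?_, ?_, ?_, ?_, ?_, ?_, ?_, ?_, ?_⟩ <;> ext1 i <;> fin_cases i <;> rfl

/-- Combine two lists of bits digit by digit, with a carry. -/
def zipBits (op : Bool → Bool → Bool → Bool × Bool) :
    Bool → List Bool → List Bool → List Bool × Bool
  | c, [], _ => ([], c)
  | c, x :: xs, ys =>
    let o := op x (ys.head?.getD false) c
    let p := zipBits op o.2 xs ys.tail
    (o.1 :: p.1, p.2)

/-- Digitwise addition. -/
def addOp (x y c : Bool) : Bool × Bool := (x ^^ y ^^ c, (x && y) || (x && c) || (y && c))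

/-- Digitwise subtraction. -/
def subOp (x y c : Bool) : Bool × Bool := (x ^^ y ^^ c, (!x && y) || (!x && c) || (y && c))

theorem length_zipBits (op : Bool → Bool → Bool → Bool × Bool) (c : Bool) (xs ys : List Bool) :
    (zipBits op c xs ys).1.length = xs.length := by
  induction xs generalizing c ys with
  | nil => rfl
  | cons x xs ih => simp [zipBits, ih]

/-- At each position, result digit plus twice the carry is the sum of the two digits and the
incoming carry. The length condition ensures that no digit of `ys` is dropped. -/
theorem bitsVal_zipBits_addOp (c : Bool) {xs ys : List Bool} (h : ys.length ≤ xs.length) :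
    bitsVal (zipBits addOp c xs ys).1 + 2 ^ xs.length * (zipBits addOp c xs ys).2.toNat =
      bitsVal xs + bitsVal ys + c.toNat := by
  induction xs generalizing c ys with
  | nil =>
    obtain rfl : ys = [] := by simpa using h
    simp [zipBits]
  | cons x xs ih =>
    cases ys with
    | nil =>
      have := ih (addOp x false c).2 (ys := []) (by simp)
      simp only [zipBits, List.head?_nil, Option.getD_none, List.tail_nil, bitsVal_cons,
        List.length_cons, pow_succ, bitsVal_nil] at this ⊢
      cases x <;> cases c <;> simp [addOp] at this ⊢ <;> linarith
    | cons y ys =>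
      have := ih (addOp x y c).2 (ys := ys) (by simpa using h)
      simp only [zipBits, List.head?_cons, Option.getD_some, List.tail_cons, bitsVal_cons,
        List.length_cons, pow_succ] at this ⊢
      cases x <;> cases y <;> cases c <;> simp [addOp] at this ⊢ <;> linarith

/-- The subtrahend stands on the left to avoid truncated subtraction. Since the result is below `2 ^
xs.length`, the final borrow tells whether `ys` and the incoming borrow together exceed `xs`. -/
theorem bitsVal_zipBits_subOp (c : Bool) {xs ys : List Bool} (h : ys.length ≤ xs.length) :
    bitsVal (zipBits subOp c xs ys).1 + bitsVal ys + c.toNat =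
      bitsVal xs + 2 ^ xs.length * (zipBits subOp c xs ys).2.toNat := by
  induction xs generalizing c ys with
  | nil =>
    obtain rfl : ys = [] := by simpa using h
    simp [zipBits]
  | cons x xs ih =>
    cases ys with
    | nil =>
      have := ih (subOp x false c).2 (ys := []) (by simp)
      simp only [zipBits, List.head?_nil, Option.getD_none, List.tail_nil, bitsVal_cons,
        List.length_cons, pow_succ, bitsVal_nil] at this ⊢
      cases x <;> cases c <;> simp [subOp] at this ⊢ <;> linarith
    | cons y ys =>
      have := ih (subOp x y c).2 (ys := ys) (by simpa using h)
      simp only [zipBits, List.head?_cons, Option.getD_some, List.tail_cons, bitsVal_cons,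
        List.length_cons, pow_succ] at this ⊢
      cases x <;> cases y <;> cases c <;> simp [subOp] at this ⊢ <;> linarith

/-- The part of `zipBody` that follows after a bit of the second operand has been read. -/
noncomputable def zipBodyTail (op : Bool → Bool → Bool → Bool × Bool) (x : Bool)
    (y : Option Bool) : StackProg (Fin 9) :=
  (y.elim (skip _) (push 6)).seq <| popCase 8 fun c =>
    (push 7 (op x (y.getD false) (c.getD false)).1).seq
      (push 8 (op x (y.getD false) (c.getD false)).2)

/-- The treatment of one digit in `zipLoop`. -/
noncomputable def zipBody (op : Bool → Bool → Bool → Bool × Bool) (x : Bool) :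
    StackProg (Fin 9) :=
  (push 5 x).seq (popCase 1 (zipBodyTail op x))

/-- Combine the numbers on the stacks `3` and `1` digit by digit. The carry is on the stack `8`, the
result is pushed onto the stack `7`, and the operands are saved on the stacks `5` and `6`. -/
noncomputable def zipLoop (op : Bool → Bool → Bool → Bool × Bool) : StackProg (Fin 9) :=
  loop 3 (zipBody op)

theorem runs_zipBody (op : Bool → Bool → Bool → Bool × Bool) (x : Bool)
    (l₀ l₁ l₂ l₃ l₄ l₅ l₆ l₇ : List Bool) (c : Bool) :
    (zipBody op x).Runs (regs l₀ l₁ l₂ l₃ l₄ l₅ l₆ l₇ [c])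
      (regs l₀ l₁.tail l₂ l₃ l₄ (x :: l₅) ((l₁.take 1).reverse ++ l₆)
        ((op x (l₁.head?.getD false) c).1 :: l₇) [(op x (l₁.head?.getD false) c).2]) 6 := by
  have h₁ := runs_push 5 x (regs l₀ l₁ l₂ l₃ l₄ l₅ l₆ l₇ [c])
  simp only [regs_apply, regs_update] at h₁
  refine (h₁.seq (Runs.popCase (t := 4) ?_)).mono le_rfl
  simp only [regs_apply, regs_update]
  have h₂ : (l₁.head?.elim (skip (Fin 9)) (push 6)).Runs
      (regs l₀ l₁.tail l₂ l₃ l₄ (x :: l₅) l₆ l₇ [c])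
      (regs l₀ l₁.tail l₂ l₃ l₄ (x :: l₅) ((l₁.take 1).reverse ++ l₆) l₇ [c]) 1 := by
    cases l₁ with
    | nil => exact runs_skip _
    | cons y l₁ =>
      have h := runs_push 6 y (regs l₀ l₁ l₂ l₃ l₄ (x :: l₅) l₆ l₇ [c])
      simp only [regs_apply, regs_update] at h
      exact h
  refine (h₂.seq (t' := 3) (Runs.popCase (t := 2) ?_)).mono le_rfl
  simp only [regs_apply, regs_update, List.head?_cons, List.tail_cons, Option.getD_some]
  have h := (runs_push 7 (op x (l₁.head?.getD false) c).1
    (regs l₀ l₁.tail l₂ l₃ l₄ (x :: l₅) ((l₁.take 1).reverse ++ l₆) l₇ [])).seq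
    (runs_push 8 (op x (l₁.head?.getD false) c).2 _)
  simp only [regs_apply, regs_update] at h
  exact h

/-- Everything pushed during the loop lies in reverse order on its stack. A single `move` of the
result or of a saved operand restores the order of its digits. -/
theorem runs_zipLoop (op : Bool → Bool → Bool → Bool × Bool)
    (l₀ l₁ l₂ l₃ l₄ l₅ l₆ l₇ : List Bool) (c : Bool) :
    (zipLoop op).Runs (regs l₀ l₁ l₂ l₃ l₄ l₅ l₆ l₇ [c])
      (regs l₀ (l₁.drop l₃.length) l₂ [] l₄ (l₃.reverse ++ l₅) ((l₁.take l₃.length).reverse ++ l₆)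
        ((zipBits op c l₃ l₁).1.reverse ++ l₇) [(zipBits op c l₃ l₁).2])
      (7 * l₃.length + 1) := by
  induction l₃ generalizing l₁ l₅ l₆ l₇ c with
  | nil =>
    exact runs_loop_nil (k := 3) (zipBody op) (regs_apply l₀ l₁ l₂ [] l₄ l₅ l₆ l₇ [c]).2.2.2.1
  | cons x l₃ ih =>
    have h := runs_loop_cons (S := regs l₀ l₁ l₂ (x :: l₃) l₄ l₅ l₆ l₇ [c]) (k := 3)
      (P := zipBody op) (regs_apply l₀ l₁ l₂ (x :: l₃) l₄ l₅ l₆ l₇ [c]).2.2.2.1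
      (by simpa only [regs_update] using runs_zipBody op x l₀ l₁ l₂ l₃ l₄ l₅ l₆ l₇ c)
      (ih _ _ _ _ _)
    refine h.to ?_ (by simp; omega)
    cases l₁ <;> simp [zipBits]

end StackProg

/-! ### Normal form of digit strings, and strings of zeros. -/

namespace StackProg

/-- Remove leading zeros from the number on the stack `3`, which is read from the stack `4`. -/
noncomputable def normalize : StackProg (Fin 9) := (move 3 4).seq (loop 4 (pushBit 3))

/-- The first `move` brings the most significant digit to the top. Horner's scheme with `pushBit`
then ignores leading zeros, because appending the digit `0` to the number `0` leaves the stack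
empty. -/
theorem runs_normalize (l₀ l₁ l₂ l₃ l₅ l₆ l₇ l₈ : List Bool) :
    normalize.Runs (regs l₀ l₁ l₂ l₃ [] l₅ l₆ l₇ l₈)
      (regs l₀ l₁ l₂ (bitsVal l₃).bits [] l₅ l₆ l₇ l₈) (6 * l₃.length + 2) := by
  have key : ∀ (l : List Bool) (n : ℕ), (loop 4 (pushBit 3)).Runs
      (regs l₀ l₁ l₂ n.bits l l₅ l₆ l₇ l₈)
      (regs l₀ l₁ l₂ (l.foldl (fun n b => 2 * n + b.toNat) n).bits [] l₅ l₆ l₇ l₈)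
      (4 * l.length + 1) := by
    intro l
    induction l with
    | nil => exact fun n => runs_loop_nil _ rfl
    | cons b l ih =>
      intro n
      have h := runs_pushBit 3 b (n := n) (S := regs l₀ l₁ l₂ n.bits l l₅ l₆ l₇ l₈) rfl
      simp only [regs_update] at h
      -- The body starts after `b` has been popped; `runs_loop_cons` expects this configuration as
      -- an update of the one before.
      rw [← (regs_update l₀ l₁ l₂ n.bits (b :: l) l₅ l₆ l₇ l₈ l).2.2.2.2.1] at h
      exact (runs_loop_cons (k := 4) (b := b) (l := l) rfl h (ih (2 * n + b.toNat))).mono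
        (by simp; omega)
  have hval : ∀ l : List Bool, bitsVal l = l.reverse.foldl (fun n b => 2 * n + b.toNat) 0 := by
    intro l
    induction l with
    | nil => rfl
    | cons b l ih => simp [ih]
  have h₁ := runs_move (k := (3 : Fin 9)) (k' := 4) (by decide) (regs l₀ l₁ l₂ l₃ [] l₅ l₆ l₇ l₈)
  simp only [regs_apply, regs_update, List.append_nil] at h₁
  have h₂ := key l₃.reverse 0
  rw [← hval, Nat.zero_bits] at h₂
  exact (h₁.seq h₂).mono (by simp; omega)

/-- Push as many zeros onto the stack `3` as there are bits on the stack `1`. -/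
noncomputable def zeros : StackProg (Fin 9) :=
  (loop 1 fun b => (push 3 false).seq (push 6 b)).seq (move 6 1)

/-- A zero as wide as the second operand serves as the initial remainder or product. With this width
the length conditions of digitwise addition and subtraction hold from the first digit on. -/
theorem runs_zeros (l₀ l₁ l₂ l₄ l₅ l₇ l₈ : List Bool) :
    zeros.Runs (regs l₀ l₁ l₂ [] l₄ l₅ [] l₇ l₈)
      (regs l₀ l₁ l₂ (List.replicate l₁.length false) l₄ l₅ [] l₇ l₈) (5 * l₁.length + 2) := by
  have key : ∀ (l l₃ l₆ : List Bool), (loop 1 fun b => (push 3 false).seq (push 6 b)).Runs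
      (regs l₀ l l₂ l₃ l₄ l₅ l₆ l₇ l₈)
      (regs l₀ [] l₂ (List.replicate l.length false ++ l₃) l₄ l₅ (l.reverse ++ l₆) l₇ l₈)
      (3 * l.length + 1) := by
    intro l
    induction l with
    | nil => exact fun _ _ => runs_loop_nil _ rfl
    | cons b l ih =>
      intro l₃ l₆
      have h := (runs_push 3 false (regs l₀ l l₂ l₃ l₄ l₅ l₆ l₇ l₈)).seq (runs_push 6 b _)
      simp only [regs_apply, regs_update] at h
      rw [← (regs_update l₀ (b :: l) l₂ l₃ l₄ l₅ l₆ l₇ l₈ l).2.1] at h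
      refine (runs_loop_cons (k := 1) (b := b) (l := l)
        (P := fun b => (push 3 false).seq (push 6 b)) rfl h (ih _ _)).to ?_ (by simp; omega)
      simp [List.replicate_succ']
  have h₁ := key l₁ [] []
  have h₂ := runs_move (k := (6 : Fin 9)) (k' := 1) (by decide)
    (regs l₀ [] l₂ (List.replicate l₁.length false) l₄ l₅ l₁.reverse l₇ l₈)
  simp only [regs_apply, regs_update, List.append_nil, List.reverse_reverse] at h₁ h₂
  exact (h₁.seq h₂).mono (by simp; omega)

/-! #### Division -/

/-- The end of `divStep`, depending on the borrow. -/
noncomputable def divStepTail : Option Bool → StackProg (Fin 9)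
  | some true => (pushBit 2 false).seq <| (clear 7).seq <| (move 5 3).seq (move 6 1)
  | _ => (pushBit 2 true).seq <| (clear 5).seq <| (move 7 3).seq (move 6 1)

/-- Long division of a number by the number on the stack `1`: the treatment of one digit of the
dividend. The quotient is on the stack `2`, the remainder on the stack `3`. -/
noncomputable def divStep (b : Bool) : StackProg (Fin 9) :=
  ((push 3 b).seq (push 8 false)).seq <| (zipLoop subOp).seq (popCase 8 divStepTail)

/-- The new digit is appended to the remainder and the divisor is subtracted on trial. Without a
borrow the difference is kept and the quotient digit is `1`; otherwise the saved minuend is restored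
and the digit is `0`. Leading zeros of the remainder are tolerated here and removed at the end of
the division. -/
theorem runs_divStep (b : Bool) (l₀ l₁ l₃ l₄ : List Bool) (q : ℕ)
    (hl : l₁.length ≤ l₃.length + 1) :
    ∃ l : List Bool, l.length = l₃.length + 1 ∧
      bitsVal l = (if bitsVal l₁ ≤ 2 * bitsVal l₃ + b.toNat then
        2 * bitsVal l₃ + b.toNat - bitsVal l₁ else 2 * bitsVal l₃ + b.toNat) ∧
      (divStep b).Runs (regs l₀ l₁ q.bits l₃ l₄ [] [] [] [])
        (regs l₀ l₁ (2 * q + (decide (bitsVal l₁ ≤ 2 * bitsVal l₃ + b.toNat)).toNat).bits l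
          l₄ [] [] [] []) (20 * (l₃.length + 1) + 20) := by
  obtain ⟨z, hz⟩ : ∃ z, z = zipBits subOp false (b :: l₃) l₁ := ⟨_, rfl⟩
  have hlen : z.1.length = l₃.length + 1 := by rw [hz, length_zipBits]; rfl
  have hval := bitsVal_zipBits_subOp false (xs := b :: l₃) (ys := l₁) (by simpa using hl)
  rw [← hz] at hval
  have hlt := bitsVal_lt z.1
  have hlt₁ := (bitsVal_lt l₁).trans_le (Nat.pow_le_pow_right (by norm_num) hl)
  have h₁ := (runs_push 3 b (regs l₀ l₁ q.bits l₃ l₄ [] [] [] [])).seq (runs_push 8 false _)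
  simp only [regs_apply, regs_update] at h₁
  have h₂ := runs_zipLoop subOp l₀ l₁ q.bits (b :: l₃) l₄ [] [] [] false
  rw [← hz, List.drop_of_length_le (by simpa using hl),
    List.take_of_length_le (by simpa using hl)] at h₂
  simp only [List.append_nil] at h₂
  have hlen₁ : l₁.reverse.length = l₁.length := List.length_reverse
  by_cases hc : bitsVal l₁ ≤ 2 * bitsVal l₃ + b.toNat
  -- With a borrow the result would be at least `2 ^ (l₃.length + 1)`, too large for its number of
  -- digits.
  · have hz₂ : z.2 = false := by
      by_contra h
      rw [Bool.not_eq_false] at h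
      simp only [bitsVal_cons, List.length_cons, h, Bool.toNat_true, Bool.toNat_false] at hval
      rw [hlen] at hlt
      omega
    rw [hz₂] at h₂ hval
    refine ⟨z.1, hlen, ?_, ?_⟩
    · rw [if_pos hc]
      simp only [bitsVal_cons, Bool.toNat_false] at hval
      omega
    · have h₃ := (runs_pushBit 2 true (n := q)
        (S := regs l₀ [] q.bits [] l₄ (b :: l₃).reverse l₁.reverse z.1.reverse []) rfl)
      simp only [regs_update] at h₃
      have h₄ := h₃.seq <| (runs_clear 5 _).seq <|
        (runs_move (k := 7) (k' := 3) (by decide) _).seq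
          (runs_move (k := 6) (k' := 1) (by decide) _)
      simp only [regs_apply, regs_update, List.append_nil, List.reverse_reverse] at h₄
      rw [← (regs_update l₀ [] q.bits [] l₄ (b :: l₃).reverse l₁.reverse z.1.reverse
        [false] []).2.2.2.2.2.2.2.2] at h₄
      refine (h₁.seq (h₂.seq (Runs.popCase (k := 8) (P := divStepTail) h₄))).to ?_ ?_
      · simp [hc]
      · simp only [List.length_reverse, List.length_cons]
        omega
  -- Without a borrow the minuend would be the divisor plus the result, hence not smaller than the
  -- divisor.
  · have hz₂ : z.2 = true := by
      by_contra h
      rw [Bool.not_eq_true] at h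
      simp only [bitsVal_cons, List.length_cons, h, Bool.toNat_false] at hval
      omega
    rw [hz₂] at h₂ hval
    refine ⟨b :: l₃, rfl, ?_, ?_⟩
    · rw [if_neg hc, bitsVal_cons]
    · have h₃ := (runs_pushBit 2 false (n := q)
        (S := regs l₀ [] q.bits [] l₄ (b :: l₃).reverse l₁.reverse z.1.reverse []) rfl)
      simp only [regs_update] at h₃
      have h₄ := h₃.seq <| (runs_clear 7 _).seq <|
        (runs_move (k := 5) (k' := 3) (by decide) _).seq
          (runs_move (k := 6) (k' := 1) (by decide) _)
      simp only [regs_apply, regs_update, List.append_nil, List.reverse_reverse] at h₄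
      rw [← (regs_update l₀ [] q.bits [] l₄ (b :: l₃).reverse l₁.reverse z.1.reverse
        [true] []).2.2.2.2.2.2.2.2] at h₄
      refine (h₁.seq (h₂.seq (Runs.popCase (k := 8) (P := divStepTail) h₄))).to ?_ ?_
      · simp [hc]
      · simp only [List.length_reverse, List.length_cons]
        omega

/-- The invariant: `n` is the number formed by the digits read so far, and the stacks `2` and `3`
hold its quotient and remainder. The remainder gains one digit for each digit read, so `l₃.length +
l₄.length` is constant and bounds the width throughout. -/
theorem runs_loop_divStep (l₀ l₁ : List Bool) (h₁ : 0 < bitsVal l₁) (l₄ l₃ : List Bool) (n : ℕ)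
    (hl : l₁.length ≤ l₃.length + 1) (hn : bitsVal l₃ = n % bitsVal l₁) :
    ∃ l : List Bool, l.length = l₃.length + l₄.length ∧
      bitsVal l = (l₄.foldl (fun n b => 2 * n + b.toNat) n) % bitsVal l₁ ∧
      (loop 4 divStep).Runs (regs l₀ l₁ (n / bitsVal l₁).bits l₃ l₄ [] [] [] [])
        (regs l₀ l₁ ((l₄.foldl (fun n b => 2 * n + b.toNat) n) / bitsVal l₁).bits l
          [] [] [] [] []) ((20 * (l₃.length + l₄.length) + 21) * l₄.length + 1) := by
  induction l₄ generalizing l₃ n with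
  | nil => exact ⟨l₃, rfl, hn, runs_loop_nil _ rfl⟩
  | cons b l₄ ih =>
    obtain ⟨l, hlen, hval, h⟩ := runs_divStep b l₀ l₁ l₃ l₄ (n / bitsVal l₁) hl
    have hb : b.toNat ≤ 1 := Bool.toNat_le b
    have hmod := Nat.mod_lt n h₁
    have hdm := Nat.div_add_mod n (bitsVal l₁)
    -- As the old remainder is below the divisor, `2 * bitsVal l₃ + b.toNat` is below twice the
    -- divisor, so at most one subtraction is needed.
    have key : (2 * n + b.toNat) / bitsVal l₁ = 2 * (n / bitsVal l₁) +
        (decide (bitsVal l₁ ≤ 2 * bitsVal l₃ + b.toNat)).toNat ∧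
        (2 * n + b.toNat) % bitsVal l₁ = bitsVal l := by
      rw [Nat.div_mod_unique h₁, hval, hn]
      generalize n % bitsVal l₁ = r at *
      generalize n / bitsVal l₁ = q at *
      generalize bitsVal l₁ = m at *
      subst hdm
      split_ifs with hc
      · simp only [hc, decide_true, Bool.toNat_true]
        refine ⟨?_, by omega⟩
        zify [hc]
        ring
      · simp only [hc, decide_false, Bool.toNat_false]
        refine ⟨by ring, by omega⟩
    obtain ⟨l', hlen', hval', h'⟩ := ih l (2 * n + b.toNat) (by omega) key.2.symm
    refine ⟨l', by simp; omega, hval', ?_⟩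
    rw [← key.1, ← (regs_update l₀ l₁ _ l₃ (b :: l₄) [] [] [] [] l₄).2.2.2.2.1] at h
    refine (runs_loop_cons (k := 4) (b := b) (l := l₄) rfl h h').mono ?_
    simp only [hlen, List.length_cons]
    nlinarith

/-- Division with remainder of the number on the stack `0` by the number on the stack `1`. The
quotient is written on the stack `2`, the remainder on the stack `3`. -/
noncomputable def divMod : StackProg (Fin 9) :=
  zeros.seq <| (move 0 4).seq <| (loop 4 divStep).seq normalize

theorem foldl_reverse_bits (n : ℕ) :
    n.bits.reverse.foldl (fun n b => 2 * n + b.toNat) 0 = n := by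
  conv_rhs => rw [← bitsVal_bits n]
  generalize n.bits = l
  induction l with
  | nil => rfl
  | cons b l ih => simp [ih]

theorem runs_divMod (s : ℕ) {a : ℕ} (ha : 0 < a) :
    divMod.Runs (regs s.bits a.bits [] [] [] [] [] [] [])
      (regs [] a.bits (s / a).bits (s % a).bits [] [] [] [] [])
      (40 * (s.bits.length + a.bits.length + 1) ^ 2) := by
  have h₁ := runs_zeros s.bits a.bits [] [] [] [] []
  have h₂ := runs_move (k := 0) (k' := 4) (by decide)
    (regs s.bits a.bits [] (List.replicate a.bits.length false) [] [] [] [] [])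
  simp only [regs_apply, regs_update, List.append_nil] at h₂
  have h0 : bitsVal (List.replicate a.bits.length false) = 0 := by
    generalize a.bits.length = n
    induction n with
    | zero => rfl
    | succ n ih => simp [List.replicate_succ, ih]
  obtain ⟨l, hlen, hval, h₃⟩ := runs_loop_divStep [] a.bits (by simpa using ha) s.bits.reverse
    (List.replicate a.bits.length false) 0 (by simp) (by simp [h0])
  rw [foldl_reverse_bits, bitsVal_bits] at hval h₃
  have h₄ := runs_normalize [] a.bits (s / a).bits l [] [] [] []
  rw [hval] at h₄
  simp only [Nat.zero_div, Nat.zero_bits] at h₃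
  refine (h₁.seq (h₂.seq (h₃.seq h₄))).mono ?_
  simp only [hlen, List.length_reverse, List.length_replicate]
  nlinarith

/-! #### Multiplication -/

/-- The end of `mulStep`. -/
noncomputable def mulStepTail (_ : Option Bool) : StackProg (Fin 9) :=
  (clear 5).seq <| (move 7 3).seq (move 6 1)

/-- Multiplication of a number by the number on the stack `1`: the treatment of one digit of the
first factor. The product is on the stack `3`. -/
noncomputable def mulStep (b : Bool) : StackProg (Fin 9) :=
  (push 3 false).seq <|
    if b then (push 8 false).seq <| (zipLoop addOp).seq (popCase 8 mulStepTail) else skip _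

/-- Pushing `false` doubles the product, and the second factor is added if the digit is `1`. By
`hlt` the sum fits into the available digits, so the final carry vanishes and may be discarded. -/
theorem runs_mulStep (b : Bool) (l₀ l₁ l₂ l₃ l₄ : List Bool) (hl : l₁.length ≤ l₃.length + 1)
    (hlt : 2 * bitsVal l₃ + b.toNat * bitsVal l₁ < 2 ^ (l₃.length + 1)) :
    ∃ l : List Bool, l.length = l₃.length + 1 ∧
      bitsVal l = 2 * bitsVal l₃ + b.toNat * bitsVal l₁ ∧
      (mulStep b).Runs (regs l₀ l₁ l₂ l₃ l₄ [] [] [] [])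
        (regs l₀ l₁ l₂ l l₄ [] [] [] []) (20 * (l₃.length + 1) + 20) := by
  have h₀ := runs_push 3 false (regs l₀ l₁ l₂ l₃ l₄ [] [] [] [])
  simp only [regs_apply, regs_update] at h₀
  cases b with
  | false => exact ⟨false :: l₃, rfl, by simp, (h₀.seq (runs_skip _)).mono (by omega)⟩
  | true =>
    obtain ⟨z, hz⟩ : ∃ z, z = zipBits addOp false (false :: l₃) l₁ := ⟨_, rfl⟩
    have hlen : z.1.length = l₃.length + 1 := by rw [hz, length_zipBits]; rfl
    have hval := bitsVal_zipBits_addOp false (xs := false :: l₃) (ys := l₁) (by simpa using hl)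
    rw [← hz] at hval
    have h₁ := runs_push 8 false (regs l₀ l₁ l₂ (false :: l₃) l₄ [] [] [] [])
    simp only [regs_apply, regs_update] at h₁
    have h₂ := runs_zipLoop addOp l₀ l₁ l₂ (false :: l₃) l₄ [] [] [] false
    rw [← hz, List.drop_of_length_le (by simpa using hl),
      List.take_of_length_le (by simpa using hl)] at h₂
    simp only [List.append_nil] at h₂
    have hz₂ : z.2 = false := by
      by_contra h
      rw [Bool.not_eq_false] at h
      simp only [bitsVal_cons, List.length_cons, h, Bool.toNat_true, Bool.toNat_false] at hval hlt
      omega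
    refine ⟨z.1, hlen, ?_, ?_⟩
    · simp only [hz₂, bitsVal_cons, Bool.toNat_false, Bool.toNat_true] at hval ⊢
      omega
    · have h₄ := (runs_clear 5
        (regs l₀ [] l₂ [] l₄ (false :: l₃).reverse l₁.reverse z.1.reverse [])).seq <|
        (runs_move (k := 7) (k' := 3) (by decide) _).seq
          (runs_move (k := 6) (k' := 1) (by decide) _)
      simp only [regs_apply, regs_update, List.append_nil, List.reverse_reverse] at h₄
      rw [← (regs_update l₀ [] l₂ [] l₄ (false :: l₃).reverse l₁.reverse z.1.reverse
        [z.2] []).2.2.2.2.2.2.2.2] at h₄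
      refine (h₀.seq (h₁.seq (h₂.seq
        (Runs.popCase (k := 8) (P := mulStepTail) h₄)))).mono ?_
      simp only [List.length_reverse, List.length_cons]
      omega

/-- The bound on `(n + 1) * bitsVal l₁`, rather than on the product alone, is inherited: `2 * n +
b.toNat + 1 ≤ 2 * (n + 1)`, while the width grows by one. At the end it leaves room for adding a
number below the second factor. -/
theorem runs_loop_mulStep (l₀ l₁ l₂ l₄ l₃ : List Bool) (n : ℕ)
    (hl : l₁.length ≤ l₃.length + 1) (hn : bitsVal l₃ = n * bitsVal l₁)
    (hlt : (n + 1) * bitsVal l₁ ≤ 2 ^ l₃.length) :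
    ∃ l : List Bool, l.length = l₃.length + l₄.length ∧
      bitsVal l = (l₄.foldl (fun n b => 2 * n + b.toNat) n) * bitsVal l₁ ∧
      ((l₄.foldl (fun n b => 2 * n + b.toNat) n) + 1) * bitsVal l₁ ≤ 2 ^ l.length ∧
      (loop 4 mulStep).Runs (regs l₀ l₁ l₂ l₃ l₄ [] [] [] [])
        (regs l₀ l₁ l₂ l [] [] [] [] [])
        ((20 * (l₃.length + l₄.length) + 21) * l₄.length + 1) := by
  induction l₄ generalizing l₃ n with
  | nil => exact ⟨l₃, rfl, hn, hlt, runs_loop_nil _ rfl⟩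
  | cons b l₄ ih =>
    have hb : b.toNat ≤ 1 := Bool.toNat_le b
    have hp : 0 < 2 ^ l₃.length := by positivity
    have hlt' : (2 * n + b.toNat + 1) * bitsVal l₁ ≤ 2 ^ (l₃.length + 1) := by
      rw [pow_succ]
      nlinarith
    obtain ⟨l, hlen, hval, h⟩ := runs_mulStep b l₀ l₁ l₂ l₃ l₄ hl (by
      rcases Nat.eq_zero_or_pos (bitsVal l₁) with h0 | h0
      · simp [hn, h0]
      · rw [hn]
        nlinarith)
    obtain ⟨l', hlen', hval', hlt'', h'⟩ := ih l (2 * n + b.toNat) (by omega)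
      (by rw [hval, hn]; ring) (by rwa [hlen])
    refine ⟨l', by simp; omega, hval', hlt'', ?_⟩
    rw [← (regs_update l₀ l₁ l₂ l₃ (b :: l₄) [] [] [] [] l₄).2.2.2.2.1] at h
    refine (runs_loop_cons (k := 4) (b := b) (l := l₄) rfl h h').mono ?_
    simp only [hlen, List.length_cons]
    nlinarith

/-- Multiplication of the number on the stack `0` by the number on the stack `1`, and addition of
the number on the stack `2`, which is smaller than that on the stack `1`. The result is written on
the stack `3`. -/
noncomputable def mulAdd : StackProg (Fin 9) :=
  zeros.seq <| (move 0 4).seq <| (loop 4 mulStep).seq <| (clear 1).seq <| (move 2 5).seq <|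
    (move 5 1).seq <| (push 8 false).seq <| (zipLoop addOp).seq <| (move 7 3).seq normalize

/-- Only the stack `3` is of interest; leftovers of the last addition remain on other stacks. -/
theorem runs_mulAdd (j : ℕ) {a β : ℕ} (hβ : β < a) :
    ∃ S, mulAdd.Runs (regs j.bits a.bits β.bits [] [] [] [] [] []) S
      (60 * (j.bits.length + a.bits.length + 1) ^ 2) ∧ S 3 = (j * a + β).bits := by
  have h₁ := runs_zeros j.bits a.bits β.bits [] [] [] []
  have h₂ := runs_move (k := 0) (k' := 4) (by decide)
    (regs j.bits a.bits β.bits (List.replicate a.bits.length false) [] [] [] [] [])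
  simp only [regs_apply, regs_update, List.append_nil] at h₂
  have h0 : bitsVal (List.replicate a.bits.length false) = 0 := by
    generalize a.bits.length = n
    induction n with
    | zero => rfl
    | succ n ih => simp [List.replicate_succ, ih]
  obtain ⟨l, hlen, hval, hlt, h₃⟩ := runs_loop_mulStep [] a.bits β.bits j.bits.reverse
    (List.replicate a.bits.length false) 0 (by simp) (by simp [h0])
    (by simpa using (bitsVal_lt a.bits).le)
  rw [foldl_reverse_bits, bitsVal_bits] at hval hlt
  simp only [List.length_reverse, List.length_replicate] at hlen h₃
  have hβa : β.bits.length ≤ a.bits.length := by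
    rw [Nat.size_eq_bits_len, Nat.size_eq_bits_len]
    exact Nat.size_le_size hβ.le
  obtain ⟨z, hz⟩ : ∃ z, z = zipBits addOp false l β.bits := ⟨_, rfl⟩
  have hzlen : z.1.length = l.length := by rw [hz, length_zipBits]
  have hzval := bitsVal_zipBits_addOp false (xs := l) (ys := β.bits) (by omega)
  have h₅ := runs_zipLoop addOp [] β.bits [] l [] [] [] [] false
  rw [← hz] at hzval h₅
  rw [bitsVal_bits, hval] at hzval
  -- No overflow, since `j * a + β < (j + 1) * a ≤ 2 ^ l.length`.
  have hz₂ : z.2 = false := by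
    by_contra h
    rw [Bool.not_eq_false] at h
    simp only [h, Bool.toNat_true, Bool.toNat_false] at hzval
    nlinarith
  simp only [hz₂, Bool.toNat_false, mul_zero, add_zero] at hzval
  have h₆ := runs_move (k := 7) (k' := 3) (by decide)
    (regs [] (β.bits.drop l.length) [] [] [] l.reverse (β.bits.take l.length).reverse z.1.reverse
      [z.2])
  simp only [regs_apply, regs_update, List.append_nil, List.reverse_reverse] at h₆
  simp only [List.append_nil] at h₅
  have h₇ := runs_normalize [] (β.bits.drop l.length) [] z.1 l.reverse
    (β.bits.take l.length).reverse [] [z.2]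
  refine ⟨_, Runs.mono (h₁.seq <| h₂.seq <| h₃.seq <| (runs_clear 1 _).seq <|
    (runs_move (k := 2) (k' := 5) (by decide) _).seq <|
    (runs_move (k := 5) (k' := 1) (by decide) _).seq <| (runs_push 8 false _).seq <|
    Runs.seq (by simpa only [regs_apply, regs_update, List.append_nil, List.reverse_reverse]
      using h₅) <| h₆.seq h₇) ?_, ?_⟩
  · simp only [regs_apply, regs_update, List.append_nil, List.length_reverse, hzlen, hlen]
    nlinarith
  · rw [← hzval]
    rfl

end StackProg

/-! ### Polynomial time -/

/-- `T` is bounded by a polynomial in `size`. -/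
def PolyBounded {J : Type*} (T size : J → ℕ) : Prop :=
  ∃ C c : ℕ, ∀ j, T j ≤ C * (size j + 1) ^ c

namespace PolyBounded

variable {J : Type*} {T T' size : J → ℕ}

theorem mono (h : PolyBounded T size) (hT : ∀ j, T' j ≤ T j) : PolyBounded T' size := by
  obtain ⟨C, c, h⟩ := h
  exact ⟨C, c, fun j => (hT j).trans (h j)⟩

theorem const (n : ℕ) : PolyBounded (fun _ => n) size := ⟨n, 0, fun j => by simp⟩

theorem self : PolyBounded size size := ⟨1, 1, fun j => by simp⟩

theorem add (h : PolyBounded T size) (h' : PolyBounded T' size) :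
    PolyBounded (fun j => T j + T' j) size := by
  obtain ⟨C, c, h⟩ := h
  obtain ⟨C', c', h'⟩ := h'
  refine ⟨C + C', max c c', fun j => ?_⟩
  rw [add_mul]
  exact add_le_add
    ((h j).trans (Nat.mul_le_mul_left _
      (Nat.pow_le_pow_right (Nat.succ_pos _) (le_max_left _ _))))
    ((h' j).trans (Nat.mul_le_mul_left _
      (Nat.pow_le_pow_right (Nat.succ_pos _) (le_max_right _ _))))

theorem mul (h : PolyBounded T size) (h' : PolyBounded T' size) :
    PolyBounded (fun j => T j * T' j) size := by
  obtain ⟨C, c, h⟩ := h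
  obtain ⟨C', c', h'⟩ := h'
  refine ⟨C * C', c + c', fun j => ?_⟩
  calc T j * T' j ≤ (C * (size j + 1) ^ c) * (C' * (size j + 1) ^ c') :=
        Nat.mul_le_mul (h j) (h' j)
    _ = _ := by ring

theorem sum {α : Type*} (s : Finset α) {T : α → J → ℕ} (h : ∀ i, PolyBounded (T i) size) :
    PolyBounded (fun j => ∑ i ∈ s, T i j) size := by
  classical
  induction s using Finset.induction_on with
  | empty => simpa using const 0
  | insert a s ha ih => simpa only [Finset.sum_insert ha] using (h a).add ih

theorem trans {size' : J → ℕ} (h : PolyBounded T size) (h' : PolyBounded size size') :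
    PolyBounded T size' := by
  obtain ⟨C, c, h⟩ := h
  obtain ⟨C', c', h'⟩ := h'
  refine ⟨C * (C' + 1) ^ c, c' * c, fun j => (h j).trans ?_⟩
  -- This absorbs the `1` in `size j + 1` and accounts for the factor `C' + 1`.
  have h1 : 1 ≤ (size' j + 1) ^ c' := Nat.one_le_pow _ _ (Nat.succ_pos _)
  calc C * (size j + 1) ^ c ≤ C * ((C' + 1) * (size' j + 1) ^ c') ^ c := by
        gcongr
        have := h' j
        linarith
    _ = _ := by rw [mul_pow, ← pow_mul, mul_assoc]

end PolyBounded

/-! ### Copying stacks and calling subprograms. -/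

namespace StackProg

/-- Copy the stack `k` to the empty stack `k'`, using the empty stack `t`. -/
noncomputable def copy {K : Type} (t k k' : K) : StackProg K :=
  (move k t).seq (loop t fun b => (push k b).seq (push k' b))

theorem runs_copy {K : Type} [DecidableEq K] {t k k' : K} (hk : k ≠ k') (ht : t ≠ k)
    (ht' : t ≠ k') {S : K → List Bool} (hS : S t = []) (hS' : S k' = []) :
    (copy t k k').Runs S (Function.update S k' (S k)) (5 * (S k).length + 2) := by
  have key : ∀ (l : List Bool) (S : K → List Bool), S t = l →
      (loop t fun b => (push k b).seq (push k' b)).Runs S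
        (fun i => if i = t then [] else if i = k then l.reverse ++ S k else
          if i = k' then l.reverse ++ S k' else S i) (3 * l.length + 1) := by
    intro l
    induction l with
    | nil =>
      intro S hS
      refine (runs_loop_nil _ hS).to ?_ le_rfl
      ext1 i
      split_ifs <;> simp_all
    | cons b l ih =>
      intro S hS
      have h := (runs_push k b (Function.update S t l)).seq (runs_push k' b _)
      refine (runs_loop_cons (P := fun b => (push k b).seq (push k' b)) hS h (ih _ ?_)).to ?_
        (by simp; omega)
      · simp [ht, ht']
      · ext1 i
        split_ifs <;> simp_all [Ne.symm]
  have h₁ := runs_move ht.symm S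
  have h₂ := key (S k).reverse (Function.update (Function.update S k []) t ((S k).reverse ++ S t))
    (by rw [Function.update_self, hS, List.append_nil])
  refine (h₁.seq h₂).to ?_ (by simp; omega)
  ext1 i
  split_ifs with h h' h''
  · subst h; simp [ht', hS]
  · subst h'; simp [hk, ht.symm]
  · subst h''; simp [ht'.symm, hk.symm, hS']
  · simp [h, h', h'']

/-- Copy several stacks. -/
noncomputable def copyAll {K α : Type} (t : K) (src dst : α → K) : List α → StackProg K
  | [] => skip K
  | i :: l => (copy t (src i) (dst i)).seq (copyAll t src dst l)

theorem runs_copyAll {K α : Type} [DecidableEq K] {t : K} {src dst : α → K}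
    (hdst : dst.Injective) (hne : ∀ i j, src i ≠ dst j) (hsrc : ∀ i, t ≠ src i)
    (htd : ∀ i, t ≠ dst i) (l : List α) (hl : l.Nodup) {S : K → List Bool} (hS : S t = [])
    (hS' : ∀ i, i ∈ l → S (dst i) = []) :
    ∃ S', (copyAll t src dst l).Runs S S' ((l.map fun i => 5 * (S (src i)).length + 2).sum + 1) ∧
      (∀ i ∈ l, S' (dst i) = S (src i)) ∧ ∀ k, (∀ i ∈ l, dst i ≠ k) → S' k = S k := by
  induction l generalizing S with
  | nil => exact ⟨S, runs_skip S, by simp, by simp⟩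
  | cons i l ih =>
    rw [List.nodup_cons] at hl
    have h := runs_copy (hne i i) (hsrc i) (htd i) hS (hS' i (by simp))
    have hsame : ∀ j, Function.update S (dst i) (S (src i)) (src j) = S (src j) :=
      fun j => Function.update_of_ne (hne j i) _ _
    obtain ⟨S', h₁, h₂, h₃⟩ := ih hl.2 (S := Function.update S (dst i) (S (src i)))
      (by rw [Function.update_of_ne (htd i), hS])
      (fun j hj => by
        have hij : dst j ≠ dst i := fun h => hl.1 (hdst h ▸ hj)
        rw [Function.update_of_ne hij, hS' j (by simp [hj])])
    simp only [hsame] at h₁ h₂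
    refine ⟨S', (h.seq h₁).mono (by simp; omega), ?_, ?_⟩
    · intro j hj
      rcases List.mem_cons.1 hj with rfl | hj
      · rw [h₃, Function.update_self]
        intro i hi h
        exact hl.1 (hdst h ▸ hi)
      · exact h₂ j hj
    · intro k hk
      rw [h₃ k fun j hj => hk j (by simp [hj]), Function.update_of_ne (hk i (by simp)).symm]

/-- The existential hides the order of copying, which does not affect the result. The program is
chosen before the decidability instance and so serves for every instance. -/
theorem exists_runs_copy {K α : Type} [Fintype α] (t : K) (src dst : α → K)
    (hdst : dst.Injective) (hne : ∀ i j, src i ≠ dst j) (hsrc : ∀ i, t ≠ src i)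
    (htd : ∀ i, t ≠ dst i) :
    ∃ P : StackProg K, ∀ [DecidableEq K] (S : K → List Bool), S t = [] → (∀ i, S (dst i) = []) →
      P.Runs S (Function.extend dst (S ∘ src) S) (∑ i, (5 * (S (src i)).length + 2) + 1) := by
  refine ⟨copyAll t src dst Finset.univ.toList, fun S hS hS' => ?_⟩
  obtain ⟨S', h₁, h₂, h₃⟩ := runs_copyAll hdst hne hsrc htd _ (Finset.nodup_toList Finset.univ) hS
    (fun i _ => hS' i)
  refine h₁.to ?_ (by rw [Finset.sum_map_toList])
  ext1 k
  by_cases hk : ∃ i, dst i = k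
  · obtain ⟨i, rfl⟩ := hk
    rw [hdst.extend_apply, h₂ i (by simp), Function.comp_apply]
  · rw [Function.extend_apply' _ _ _ hk, h₃ k fun i _ hi => hk ⟨i, hi⟩]

/-- Copy arguments to the input stacks of a program and run it. -/
theorem exists_runs_call {K K₁ α : Type} [Fintype α] (P : StackProg K₁) {f : K₁ → K}
    (hf : f.Injective) (t : K) (src : α → K) (dst : α → K₁) (hdst : dst.Injective)
    (hsrc : ∀ i k, src i ≠ f k) (htsrc : ∀ i, t ≠ src i) (ht : ∀ k, t ≠ f k) :
    ∃ Q : StackProg K, ∀ [DecidableEq K₁] [DecidableEq K] (S : K → List Bool)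
      (S₁ : K₁ → List Bool) (T : ℕ), S t = [] → (∀ i, S (f (dst i)) = []) →
      P.Runs (Function.extend dst (S ∘ src) (S ∘ f)) S₁ T →
      Q.Runs S (Function.extend f S₁ S) (∑ i, (5 * (S (src i)).length + 2) + 1 + T) := by
  obtain ⟨C, hC⟩ := exists_runs_copy t src (f ∘ dst) (hf.comp hdst) (fun i j => hsrc i _) htsrc
    (fun i => ht _)
  refine ⟨C.seq (P.mapStacks f), fun {_ _} S S₁ T hS hS' h => ?_⟩
  have h₁ := hC S hS hS'
  refine (h₁.seq (Runs.mapStacks hf (T' := S₁) (t := T) ?_)).to ?_ le_rfl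
  · convert h using 1
    ext1 k
    by_cases hk : ∃ i, dst i = k
    · obtain ⟨i, rfl⟩ := hk
      rw [hdst.extend_apply]
      exact (hf.comp hdst).extend_apply _ _ i
    · rw [Function.extend_apply' _ _ _ hk]
      exact Function.extend_apply' _ _ _ fun ⟨i, hi⟩ => hk ⟨i, hf hi⟩
  -- The copies went only to stacks in the image of `f`, which the final contents `S₁` override.
  · ext1 k
    by_cases hk : ∃ i, f i = k
    · obtain ⟨i, rfl⟩ := hk
      rw [hf.extend_apply, hf.extend_apply]
    · rw [Function.extend_apply' _ _ _ hk, Function.extend_apply' _ _ _ hk,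
        Function.extend_apply']
      exact fun ⟨i, hi⟩ => hk ⟨dst i, hi⟩

end StackProg

/-- The stacks at the beginning of a computation: `nm` and `inp` are given, all other stacks are
empty. -/
def initStacks {N I O W : Type} (nm : N → List Bool) (inp : I → List Bool) :
    N ⊕ I ⊕ O ⊕ W → List Bool :=
  Sum.elim nm (Sum.elim inp fun _ => [])

/-- Computability in polynomial time by a program whose stacks are indexed by arbitrary types.
The input consists of `nm j`, whose length need not be bounded, and of `inp j`. -/
def PolyComp {J : Type*} {N I O : Type} (nm : J → N → List Bool) (inp : J → I → List Bool)
    (out : J → O → List Bool) (size : J → ℕ) : Prop :=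
  ∃ (W : Type) (_ : Finite W) (P : StackProg (N ⊕ I ⊕ O ⊕ W)) (T : J → ℕ), PolyBounded T size ∧
    ∀ [DecidableEq (N ⊕ I ⊕ O ⊕ W)] (j : J), ∃ S', P.Runs (initStacks (nm j) (inp j)) S' (T j) ∧
      ∀ o, S' (.inr (.inr (.inl o))) = out j o

/-! ### Composition of polynomial-time programs. -/

namespace PolyComp

variable {J : Type*} {size : J → ℕ}

/-- The same program works for every family of instances drawn from `J`. In a composition, `π` picks
the instance on which a subprogram is called. -/
theorem comap {J' : Type*} {size' : J' → ℕ} {N I O : Type} {nm : J → N → List Bool}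
    {inp : J → I → List Bool} {out : J → O → List Bool} (h : PolyComp nm inp out size)
    (π : J' → J) (hs : PolyBounded (fun j => size (π j)) size') :
    PolyComp (fun j => nm (π j)) (fun j => inp (π j)) (fun j => out (π j)) size' := by
  obtain ⟨W, hW, P, T, ⟨C, c, hT⟩, h⟩ := h
  exact ⟨W, hW, P, fun j => T (π j),
    PolyBounded.trans (size := fun j => size (π j)) ⟨C, c, fun j => hT (π j)⟩ hs,
    fun j => h (π j)⟩

/-- Relabelling stacks costs no time. Descriptions outside the image of `ν` are never looked at. -/
theorem rename {N N' I I' O : Type} {nm : J → N → List Bool} {nm' : J → N' → List Bool}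
    {inp : J → I → List Bool} {inp' : J → I' → List Bool} {out : J → O → List Bool}
    (h : PolyComp nm inp out size) {ν : N → N'} (hν : ν.Injective)
    (hnm : ∀ j n, nm' j (ν n) = nm j n) (e : I ≃ I') (hinp : ∀ j i, inp' j (e i) = inp j i) :
    PolyComp nm' inp' out size := by
  classical
  obtain ⟨W, hW, P, T, hT, h⟩ := h
  have hf : (Sum.map ν (Sum.map e (id : O ⊕ W → _))).Injective :=
    Sum.map_injective.2 ⟨hν, Sum.map_injective.2 ⟨e.injective, Function.injective_id⟩⟩
  refine ⟨W, hW, P.mapStacks (Sum.map ν (Sum.map e id)), T, hT, fun {_} j => ?_⟩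
  obtain ⟨S', h₁, h₂⟩ := h j
  refine ⟨_, StackProg.Runs.mapStacks hf (T' := S') ?_, fun o => ?_⟩
  · convert h₁ using 1
    ext1 k
    rcases k with n | i | k
    · exact hnm j n
    · exact hinp j i
    · rfl
  · rw [← h₂ o]
    exact hf.extend_apply _ _ (.inr (.inr (.inl o)))

/-- The work stacks of the composition of two programs. -/
abbrev CompWork (I₁ O₁ W₁ I₂ O₂ W₂ : Type) : Type :=
  Unit ⊕ (I₁ ⊕ O₁ ⊕ W₁) ⊕ (I₂ ⊕ O₂ ⊕ W₂)

/-- The stacks of the first program in the composition of two programs. -/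
def compFst {N₁ N₂ I O I₁ O₁ W₁ I₂ O₂ W₂ : Type} :
    N₁ ⊕ I₁ ⊕ O₁ ⊕ W₁ → (N₁ ⊕ N₂) ⊕ I ⊕ O ⊕ CompWork I₁ O₁ W₁ I₂ O₂ W₂
  | .inl n => .inl (.inl n)
  | .inr x => .inr (.inr (.inr (.inr (.inl x))))

/-- The stacks of the second program in the composition of two programs. -/
def compSnd {N₁ N₂ I O I₁ O₁ W₁ I₂ O₂ W₂ : Type} :
    N₂ ⊕ I₂ ⊕ O₂ ⊕ W₂ → (N₁ ⊕ N₂) ⊕ I ⊕ O ⊕ CompWork I₁ O₁ W₁ I₂ O₂ W₂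
  | .inl n => .inl (.inr n)
  | .inr x => .inr (.inr (.inr (.inr (.inr x))))

theorem compFst_injective {N₁ N₂ I O I₁ O₁ W₁ I₂ O₂ W₂ : Type} :
    (compFst (N₁ := N₁) (N₂ := N₂) (I := I) (O := O) (I₁ := I₁) (O₁ := O₁) (W₁ := W₁) (I₂ := I₂)
      (O₂ := O₂) (W₂ := W₂)).Injective := by
  rintro (a | a) (b | b) h <;> simp_all [compFst]

theorem compSnd_injective {N₁ N₂ I O I₁ O₁ W₁ I₂ O₂ W₂ : Type} :
    (compSnd (N₁ := N₁) (N₂ := N₂) (I := I) (O := O) (I₁ := I₁) (O₁ := O₁) (W₁ := W₁) (I₂ := I₂)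
      (O₂ := O₂) (W₂ := W₂)).Injective := by
  rintro (a | a) (b | b) h <;> simp_all [compSnd]

theorem initStacks_eq_extend {N I O W : Type} (nm : N → List Bool) (inp : I → List Bool)
    {x : I → List Bool} {S : N ⊕ I ⊕ O ⊕ W → List Bool} (hx : ∀ i, inp i = x i)
    (hN : ∀ n, S (.inl n) = nm n) (hW : ∀ w, S (.inr (.inr w)) = []) :
    Function.extend (fun i => .inr (.inl i)) x S = initStacks nm inp := by
  have hinj : (fun i => .inr (.inl i) : I → N ⊕ I ⊕ O ⊕ W).Injective := fun a b h => by
    simpa using h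
  ext1 k
  rcases k with n | i | w
  · rw [Function.extend_apply' _ _ _ (by simp), hN]
    rfl
  · rw [show (.inr (.inl i) : N ⊕ I ⊕ O ⊕ W) = (fun i => .inr (.inl i)) i from rfl,
      hinj.extend_apply, ← hx]
    rfl
  · rw [Function.extend_apply' _ _ _ (by simp), hW]
    rfl

/-- Each program runs in place on its own description stacks, which it may destroy; descriptions are
never copied, as their length is not bounded in terms of `size`. All other stacks of the two
programs become work stacks. Arguments and results are copied there and back, which is why their
lengths must be polynomially bounded. -/
theorem comp {N₁ N₂ I I₁ I₂ O O₁ O₂ : Type} [Finite I₁] [Finite I₂] [Finite O] [Finite O₁]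
    [Finite O₂] {nm₁ : J → N₁ → List Bool} {nm₂ : J → N₂ → List Bool} {inp : J → I → List Bool}
    {inp₁ : J → I₁ → List Bool} {inp₂ : J → I₂ → List Bool} {out : J → O → List Bool}
    {out₁ : J → O₁ → List Bool} {out₂ : J → O₂ → List Bool}
    (h₁ : PolyComp nm₁ inp₁ out₁ size) (h₂ : PolyComp nm₂ inp₂ out₂ size)
    (φ₁ : I₁ → I) (φ₂ : I₂ → I ⊕ O₁) (ψ : O → I ⊕ O₁ ⊕ O₂)
    (hφ₁ : ∀ j i, inp₁ j i = inp j (φ₁ i))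
    (hφ₂ : ∀ j i, inp₂ j i = Sum.elim (inp j) (out₁ j) (φ₂ i))
    (hψ : ∀ j o, out j o = Sum.elim (inp j) (Sum.elim (out₁ j) (out₂ j)) (ψ o))
    (hb₁ : ∀ i, PolyBounded (fun j => (inp₁ j i).length) size)
    (hb₂ : ∀ i, PolyBounded (fun j => (inp₂ j i).length) size)
    (hb : ∀ o, PolyBounded (fun j => (out j o).length) size) :
    PolyComp (fun j => Sum.elim (nm₁ j) (nm₂ j)) inp out size := by
  classical
  obtain ⟨W₁, _, P₁, T₁, hT₁, h₁⟩ := h₁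
  obtain ⟨W₂, _, P₂, T₂, hT₂, h₂⟩ := h₂
  have := Fintype.ofFinite I₁
  have := Fintype.ofFinite I₂
  have := Fintype.ofFinite O
  have hinj : ∀ {N I O W : Type}, (fun i => .inr (.inl i) : I → N ⊕ I ⊕ O ⊕ W).Injective := by
    intro N I O W a b h
    simpa using h
  obtain ⟨Q₁, hQ₁⟩ := P₁.exists_runs_call (K := (N₁ ⊕ N₂) ⊕ I ⊕ O ⊕ CompWork I₁ O₁ W₁ I₂ O₂ W₂)
    compFst_injective (.inr (.inr (.inr (.inl ())))) (fun i => .inr (.inl (φ₁ i)))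
    (fun i => .inr (.inl i)) hinj
    (by rintro i (k | k) <;> simp [compFst]) (by simp) (by rintro (k | k) <;> simp [compFst])
  obtain ⟨Q₂, hQ₂⟩ := P₂.exists_runs_call (K := (N₁ ⊕ N₂) ⊕ I ⊕ O ⊕ CompWork I₁ O₁ W₁ I₂ O₂ W₂)
    compSnd_injective (.inr (.inr (.inr (.inl ()))))
    (fun i => Sum.elim (fun i => .inr (.inl i)) (fun o => compFst (.inr (.inr (.inl o)))) (φ₂ i))
    (fun i => .inr (.inl i)) hinj
    (by intro i k; rcases φ₂ i with x | x <;> rcases k with k | k <;> simp [compFst, compSnd])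
    (by intro i; rcases φ₂ i with x | x <;> simp [compFst])
    (by rintro (k | k) <;> simp [compSnd])
  obtain ⟨Q₃, hQ₃⟩ := StackProg.exists_runs_copy
    (K := (N₁ ⊕ N₂) ⊕ I ⊕ O ⊕ CompWork I₁ O₁ W₁ I₂ O₂ W₂) (.inr (.inr (.inr (.inl ()))))
    (fun o => Sum.elim (fun i => .inr (.inl i)) (Sum.elim (fun o => compFst (.inr (.inr (.inl o))))
      (fun o => compSnd (.inr (.inr (.inl o))))) (ψ o))
    (fun o => .inr (.inr (.inl o))) (fun a b h => by simpa using h)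
    (by intro i k; rcases ψ i with x | x | x <;> simp [compFst, compSnd])
    (by intro i; rcases ψ i with x | x | x <;> simp [compFst, compSnd]) (by simp)
  refine ⟨CompWork I₁ O₁ W₁ I₂ O₂ W₂, inferInstance, Q₁.seq (Q₂.seq Q₃), fun j =>
    (∑ i, (5 * (inp₁ j i).length + 2) + 1 + T₁ j) +
      ((∑ i, (5 * (inp₂ j i).length + 2) + 1 + T₂ j) + (∑ o, (5 * (out j o).length + 2) + 1)),
    ?_, fun {_} j => ?_⟩
  · have key : ∀ {α : Type} [Fintype α] {x : J → α → List Bool},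
        (∀ i, PolyBounded (fun j => (x j i).length) size) →
        PolyBounded (fun j => ∑ i, (5 * (x j i).length + 2) + 1) size := fun h =>
      (PolyBounded.sum _ fun i => ((PolyBounded.const 5).mul (h i)).add
        (PolyBounded.const 2)).add (PolyBounded.const 1)
    exact ((key hb₁).add hT₁).add (((key hb₂).add hT₂).add (key hb))
  obtain ⟨S₁, hS₁, hout₁⟩ := h₁ j
  obtain ⟨S₂, hS₂, hout₂⟩ := h₂ j
  obtain ⟨S, hS⟩ : ∃ S : (N₁ ⊕ N₂) ⊕ I ⊕ O ⊕ CompWork I₁ O₁ W₁ I₂ O₂ W₂ → List Bool,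
      S = initStacks (Sum.elim (nm₁ j) (nm₂ j)) (inp j) := ⟨_, rfl⟩
  have r₁ := hQ₁ S S₁ (T₁ j) (by rw [hS]; rfl) (by rw [hS]; intro i; rfl) (by
    rw [initStacks_eq_extend (nm₁ j) (inp₁ j)]
    · exact hS₁
    · rw [hS]; exact hφ₁ j
    · rw [hS]; intro n; rfl
    · rw [hS]; intro w; rfl)
  obtain ⟨S', hS'⟩ : ∃ S', S' = Function.extend compFst S₁ S := ⟨_, rfl⟩
  rw [← hS'] at r₁
  have hS'₁ : ∀ k, S' (compFst k) = S₁ k := fun k => by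
    rw [hS', compFst_injective.extend_apply]
  have hS'₂ : ∀ k, (∀ k', compFst k' ≠ k) → S' k = S k := fun k hk => by
    rw [hS', Function.extend_apply' _ _ _ fun ⟨k', hk'⟩ => hk k' hk']
  -- The original inputs survive the first run, since that program works on copies; the second
  -- program may therefore draw on both the inputs and the first results.
  have hsrc₂ : ∀ i, S' (Sum.elim (fun i => .inr (.inl i))
      (fun o => compFst (.inr (.inr (.inl o)))) (φ₂ i)) = inp₂ j i := fun i => by
    rw [hφ₂]
    rcases φ₂ i with x | x
    · rw [Sum.elim_inl, hS'₂ _ (by rintro (k | k) <;> simp [compFst]), hS]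
      rfl
    · exact (hS'₁ _).trans (hout₁ x)
  have r₂ := hQ₂ S' S₂ (T₂ j)
    (by rw [hS'₂ _ (by rintro (k | k) <;> simp [compFst]), hS]; rfl)
    (by intro i; rw [hS'₂ _ (by rintro (k | k) <;> simp [compFst, compSnd]), hS]; rfl) (by
    rw [initStacks_eq_extend (nm₂ j) (inp₂ j)]
    · exact hS₂
    · exact fun i => (hsrc₂ i).symm
    · intro n
      rw [Function.comp_apply, hS'₂ _ (by rintro (k | k) <;> simp [compFst, compSnd]), hS]; rfl
    · intro w
      rw [Function.comp_apply, hS'₂ _ (by rintro (k | k) <;> simp [compFst, compSnd]), hS]; rfl)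
  obtain ⟨S'', hS''⟩ : ∃ S'', S'' = Function.extend compSnd S₂ S' := ⟨_, rfl⟩
  rw [← hS''] at r₂
  have hS''₁ : ∀ k, S'' (compSnd k) = S₂ k := fun k => by
    rw [hS'', compSnd_injective.extend_apply]
  have hS''₂ : ∀ k, (∀ k', compSnd k' ≠ k) → S'' k = S' k := fun k hk => by
    rw [hS'', Function.extend_apply' _ _ _ fun ⟨k', hk'⟩ => hk k' hk']
  have hsrc : ∀ o, S'' (Sum.elim (fun i => .inr (.inl i))
      (Sum.elim (fun o => compFst (.inr (.inr (.inl o))))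
      (fun o => compSnd (.inr (.inr (.inl o))))) (ψ o)) = out j o := fun o => by
    rw [hψ]
    rcases ψ o with x | x | x
    · rw [Sum.elim_inl, hS''₂ _ (by rintro (k | k) <;> simp [compSnd]),
        hS'₂ _ (by rintro (k | k) <;> simp [compFst]), hS]
      rfl
    · rw [Sum.elim_inr, Sum.elim_inl,
        hS''₂ _ (by rintro (k | k) <;> simp [compFst, compSnd]), hS'₁, hout₁]
      rfl
    · exact (hS''₁ _).trans (hout₂ x)
  have r₃ := hQ₃ S''
    (by rw [hS''₂ _ (by rintro (k | k) <;> simp [compSnd]),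
      hS'₂ _ (by rintro (k | k) <;> simp [compFst]), hS]; rfl)
    (by intro o; rw [hS''₂ _ (by rintro (k | k) <;> simp [compSnd]),
      hS'₂ _ (by rintro (k | k) <;> simp [compFst]), hS]; rfl)
  have hsrc₁ : ∀ i, S (.inr (.inl (φ₁ i))) = inp₁ j i := fun i => by rw [hS, hφ₁]; rfl
  simp only [hsrc, hsrc₂, hsrc₁] at r₁ r₂ r₃
  rw [← hS]
  refine ⟨_, r₁.seq (r₂.seq r₃), fun o => ?_⟩
  have hinjO : (fun o => .inr (.inr (.inl o)) :
      O → (N₁ ⊕ N₂) ⊕ I ⊕ O ⊕ CompWork I₁ O₁ W₁ I₂ O₂ W₂).Injective := fun a b h => by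
    simpa using h
  exact (hinjO.extend_apply _ _ o).trans (hsrc o)

end PolyComp

/-! ### Passage between numbered machines and programs, and functions of numbers. -/

theorem ComputableInPolyTime.polyComp {J : Type*} {N I : Type} {n m : ℕ}
    {inp' : J → Fin n → List Bool} {out : J → Fin m → List Bool} {size : J → ℕ}
    (h : ComputableInPolyTime inp' out size) (E : N ⊕ I ≃ Fin n) {nm : J → N → List Bool}
    {inp : J → I → List Bool} (hE : ∀ j k, inp' j (E k) = Sum.elim (nm j) (inp j) k) :
    PolyComp nm inp out size := by
  obtain ⟨M, C, c, h⟩ := h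
  have := M.finiteLabels
  have := M.finiteStates
  let P : StackProg (Fin n ⊕ Fin m ⊕ Fin M.w) := ⟨M.Λ, M.σ, M.start, M.init, M.prog⟩
  let f : Fin n ⊕ Fin m ⊕ Fin M.w ≃ N ⊕ I ⊕ Fin m ⊕ Fin M.w :=
    (Equiv.sumCongr E.symm (Equiv.refl _)).trans (Equiv.sumAssoc _ _ _)
  refine ⟨Fin M.w, inferInstance, P.mapStacks f, _, ⟨C, c, fun j => le_rfl⟩, fun {_} j => ?_⟩
  obtain ⟨⟨l, v, S'⟩, ⟨h₁⟩, h₂, h₃⟩ := h j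
  obtain rfl : l = none := h₂
  have hinit : initStacks (nm j) (inp j) ∘ f = (M.initCfg (inp' j)).stk := by
    ext1 k
    rcases k with k | k
    · obtain ⟨k, rfl⟩ := E.surjective k
      refine Eq.trans ?_ (hE j k).symm
      simp only [Function.comp_apply, f, Equiv.trans_apply, Equiv.sumCongr_apply, Sum.map_inl,
        Equiv.symm_apply_apply]
      rcases k with k | k <;> rfl
    · rfl
  refine ⟨_, StackProg.Runs.mapStacks f.injective (T' := S')
    ⟨h₁.steps, h₁.steps_le_m, v, ?_⟩, fun o => ?_⟩
  · rw [hinit]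
    exact stepsIn_of_iterate h₁.evals_in_steps
  · rw [← h₃ o]
    exact f.injective.extend_apply _ _ (.inr (.inl o))

theorem PolyComp.computableInPolyTime {J : Type*} {N I : Type} {n m : ℕ}
    {inp' : J → Fin n → List Bool} {out : J → Fin m → List Bool} {size : J → ℕ}
    {nm : J → N → List Bool} {inp : J → I → List Bool} (h : PolyComp nm inp out size)
    (E : N ⊕ I ≃ Fin n) (hE : ∀ j k, inp' j (E k) = Sum.elim (nm j) (inp j) k) :
    ComputableInPolyTime inp' out size := by
  classical
  obtain ⟨W, _, P, T, ⟨C, c, hT⟩, h⟩ := h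
  obtain ⟨w, ⟨eW⟩⟩ := Finite.exists_equiv_fin W
  let f : N ⊕ I ⊕ Fin m ⊕ W ≃ Fin n ⊕ Fin m ⊕ Fin w :=
    (Equiv.sumAssoc _ _ _).symm.trans
      (Equiv.sumCongr E (Equiv.sumCongr (Equiv.refl _) eW))
  let M : StackMachine n m :=
    ⟨w, P.Λ, P.σ, P.start, P.init, (P.mapStacks f).prog⟩
  refine ⟨M, C, c, fun j => ?_⟩
  obtain ⟨S', h₁, h₂⟩ := h j
  have hinit : (M.initCfg (inp' j)).stk ∘ f = initStacks (nm j) (inp j) := by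
    ext1 k
    rcases k with k | k | k | k
    · exact hE j (.inl k)
    · exact hE j (.inr k)
    · rfl
    · rfl
  have h₃ := StackProg.Runs.mapStacks (P := P) f.injective (S := (M.initCfg (inp' j)).stk)
    (T' := S') (by rwa [hinit])
  obtain ⟨t, ht, v, h₃⟩ := h₃
  refine ⟨_, ⟨⟨⟨t, h₃.iterate⟩, ht.trans (hT j)⟩⟩, rfl, fun o => ?_⟩
  rw [← h₂ o]
  exact f.injective.extend_apply _ _ (.inr (.inr (.inl o)))

/-- `PolyComp` for functions between tuples of natural numbers, which are given in binary. -/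
def PolyNat {J : Type*} {N I O : Type} (nm : J → N → List Bool) (num : J → I → ℕ)
    (res : J → O → ℕ) (size : J → ℕ) : Prop :=
  PolyComp nm (fun j i => (num j i).bits) (fun j o => (res j o).bits) size

theorem ComputableInPolyTime.polyNat {J : Type*} {d n m : ℕ} {inp : J → Fin (d + n) → List Bool}
    {out : J → Fin m → List Bool} {size : J → ℕ} (h : ComputableInPolyTime inp out size)
    {nm : J → Fin d → List Bool} {num : J → Fin n → ℕ} {res : J → Fin m → ℕ}
    (hinp : ∀ j, inp j = machineInput (nm j) (num j))
    (hout : ∀ j, out j = fun o => (res j o).bits) :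
    PolyNat nm num res size := by
  obtain rfl : out = fun j o => (res j o).bits := funext hout
  refine h.polyComp finSumFinEquiv fun j k => ?_
  rcases k with k | k <;> simp [hinp, machineInput]

theorem PolyNat.computableInPolyTime {J : Type*} {d d' n m : ℕ}
    {inp : J → Fin (d + d' + n) → List Bool} {out : J → Fin m → List Bool} {size : J → ℕ}
    {nm : J → Fin d → List Bool} {nm' : J → Fin d' → List Bool} {num : J → Fin n → ℕ}
    {res : J → Fin m → ℕ} (h : PolyNat (fun j => Sum.elim (nm j) (nm' j)) num res size)
    (hinp : ∀ j, inp j = machineInput (Fin.append (nm j) (nm' j)) (num j))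
    (hout : ∀ j, out j = fun o => (res j o).bits) :
    ComputableInPolyTime inp out size := by
  obtain rfl : out = fun j o => (res j o).bits := funext hout
  refine PolyComp.computableInPolyTime h
    ((Equiv.sumCongr finSumFinEquiv (Equiv.refl _)).trans finSumFinEquiv) fun j k => ?_
  rcases k with (k | k) | k <;> simp [hinp, machineInput]

theorem bits_vec_one (x : ℕ) : ![x.bits] = fun o => ((![x] : Fin 1 → ℕ) o).bits := by
  ext1 o
  fin_cases o
  rfl

theorem bits_vec_two (x y : ℕ) :
    ![x.bits, y.bits] = fun o => ((![x, y] : Fin 2 → ℕ) o).bits := by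
  ext1 o
  fin_cases o <;> rfl

theorem polyBounded_length_bits {J : Type*} {n size : J → ℕ} (h : ∀ j, Nat.log 2 (n j) ≤ size j) :
    PolyBounded (fun j => (n j).bits.length) size :=
  (PolyBounded.self.add (.const 1)).mono fun j =>
    (length_bits_le _).trans (Nat.add_le_add_right (h j) 1)

theorem PolyNat.comp {J : Type*} {size : J → ℕ} {N₁ N₂ I I₁ I₂ O O₁ O₂ : Type} [Finite I₁]
    [Finite I₂] [Finite O] [Finite O₁] [Finite O₂] {nm₁ : J → N₁ → List Bool}
    {nm₂ : J → N₂ → List Bool} {num : J → I → ℕ} {num₁ : J → I₁ → ℕ} {num₂ : J → I₂ → ℕ}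
    {res : J → O → ℕ} {res₁ : J → O₁ → ℕ} {res₂ : J → O₂ → ℕ}
    (h₁ : PolyNat nm₁ num₁ res₁ size) (h₂ : PolyNat nm₂ num₂ res₂ size)
    (φ₁ : I₁ → I) (φ₂ : I₂ → I ⊕ O₁) (ψ : O → I ⊕ O₁ ⊕ O₂)
    (hφ₁ : ∀ j i, num₁ j i = num j (φ₁ i))
    (hφ₂ : ∀ j i, num₂ j i = Sum.elim (num j) (res₁ j) (φ₂ i))
    (hψ : ∀ j o, res j o = Sum.elim (num j) (Sum.elim (res₁ j) (res₂ j)) (ψ o))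
    (hb₁ : ∀ j i, Nat.log 2 (num₁ j i) ≤ size j) (hb₂ : ∀ j i, Nat.log 2 (num₂ j i) ≤ size j)
    (hb : ∀ j o, Nat.log 2 (res j o) ≤ size j) :
    PolyNat (fun j => Sum.elim (nm₁ j) (nm₂ j)) num res size := by
  refine PolyComp.comp h₁ h₂ φ₁ φ₂ ψ (fun j i => by rw [hφ₁]) (fun j i => ?_) (fun j o => ?_)
    (fun i => polyBounded_length_bits fun j => hb₁ j i)
    (fun i => polyBounded_length_bits fun j => hb₂ j i)
    (fun o => polyBounded_length_bits fun j => hb j o)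
  · rw [hφ₂]
    rcases φ₂ i with x | x <;> rfl
  · rw [hψ]
    rcases ψ o with x | x | x <;> rfl

theorem polyNat_divMod {J : Type*} {s a size : J → ℕ} (ha : ∀ j, 0 < a j)
    (hs : ∀ j, Nat.log 2 (s j) ≤ size j) (has : ∀ j, Nat.log 2 (a j) ≤ size j) :
    PolyNat (fun _ => (Fin.elim0 : Fin 0 → List Bool)) (fun j => ![s j, a j])
      (fun j => ![s j / a j, s j % a j]) size := by
  -- The registers `0` and `1` are inputs, `2` and `3` outputs, and the other five work stacks.
  let f : Fin 9 → Fin 0 ⊕ Fin 2 ⊕ Fin 2 ⊕ Fin 5 :=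
    ![.inr (.inl 0), .inr (.inl 1), .inr (.inr (.inl 0)), .inr (.inr (.inl 1)),
      .inr (.inr (.inr 0)), .inr (.inr (.inr 1)), .inr (.inr (.inr 2)), .inr (.inr (.inr 3)),
      .inr (.inr (.inr 4))]
  have hf : f.Injective := by decide
  refine ⟨Fin 5, inferInstance, StackProg.divMod.mapStacks f,
    fun j => 40 * ((s j).bits.length + (a j).bits.length + 1) ^ 2, ?_, fun {_} j => ?_⟩
  · have h := ((polyBounded_length_bits hs).add (polyBounded_length_bits has)).add (.const 1)
    simpa only [sq] using (PolyBounded.const 40).mul (h.mul h)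
  · refine ⟨_, StackProg.Runs.mapStacks hf (T' := StackProg.regs [] (a j).bits (s j / a j).bits
      (s j % a j).bits [] [] [] [] []) ?_, fun o => ?_⟩
    · convert StackProg.runs_divMod (s j) (ha j) using 1
      ext1 k
      fin_cases k <;> rfl
    · fin_cases o
      · exact hf.extend_apply _ _ 2
      · exact hf.extend_apply _ _ 3

theorem polyNat_mulAdd {J : Type*} {x a y size : J → ℕ} (hy : ∀ j, y j < a j)
    (hxs : ∀ j, Nat.log 2 (x j) ≤ size j) (has : ∀ j, Nat.log 2 (a j) ≤ size j) :
    PolyNat (fun _ => (Fin.elim0 : Fin 0 → List Bool)) (fun j => ![x j, a j, y j])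
      (fun j => ![x j * a j + y j]) size := by
  -- Here `0`, `1` and `2` are inputs and `3` is the only output.
  let f : Fin 9 → Fin 0 ⊕ Fin 3 ⊕ Fin 1 ⊕ Fin 5 :=
    ![.inr (.inl 0), .inr (.inl 1), .inr (.inl 2), .inr (.inr (.inl 0)),
      .inr (.inr (.inr 0)), .inr (.inr (.inr 1)), .inr (.inr (.inr 2)), .inr (.inr (.inr 3)),
      .inr (.inr (.inr 4))]
  have hf : f.Injective := by decide
  refine ⟨Fin 5, inferInstance, StackProg.mulAdd.mapStacks f,
    fun j => 60 * ((x j).bits.length + (a j).bits.length + 1) ^ 2, ?_, fun {_} j => ?_⟩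
  · have h := ((polyBounded_length_bits hxs).add (polyBounded_length_bits has)).add (.const 1)
    simpa only [sq] using (PolyBounded.const 60).mul (h.mul h)
  · obtain ⟨S, h₁, h₂⟩ := StackProg.runs_mulAdd (x j) (hy j)
    refine ⟨_, StackProg.Runs.mapStacks hf (T' := S) ?_, fun o => ?_⟩
    · convert h₁ using 1
      ext1 k
      fin_cases k <;> rfl
    · fin_cases o
      exact (hf.extend_apply _ _ 3).trans h₂

/-! ### The parameters of a resolvable tactical configuration -/

/-- The relations between the parameters of a resolvable tactical configuration. -/
structure DesignParams.Proper (P : DesignParams) : Prop where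
  v_pos : 0 < P.v
  r_pos : 0 < P.r
  a_pos : 0 < P.a
  b_eq : P.b = P.r * P.a
  k_le : P.k ≤ P.v

/-- One incident pair provides a point, a class and a label, whence the positivity. It permits
division by `a` and yields `r ≤ b` and `a ≤ b`. -/
theorem IncidenceStructure.IsResolvableConfig.proper {X R A : Type*} [Finite X] [Finite R]
    [Finite A] {D : IncidenceStructure X (R × A)} {P : DesignParams}
    (h : D.IsResolvableConfig P) : P.Proper := by
  obtain ⟨x, ⟨i, γ⟩, -⟩ := h.nonempty
  have : Nonempty X := ⟨x⟩
  have : Nonempty R := ⟨i⟩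
  have : Nonempty A := ⟨γ⟩
  refine ⟨h.tactical.card_points ▸ Nat.card_pos, h.card_classes ▸ Nat.card_pos,
    h.card_labels ▸ Nat.card_pos, ?_, ?_⟩
  · rw [← h.card_blocks, Nat.card_prod, h.card_classes, h.card_labels]
  · rw [← h.tactical.ncard_points (i, γ), ← h.tactical.card_points, ← Set.ncard_univ]
    exact Set.ncard_le_ncard (Set.subset_univ _)

namespace DesignParams.Proper

variable {P : DesignParams}

theorem r_le (h : P.Proper) : P.r ≤ P.b := h.b_eq ▸ Nat.le_mul_of_pos_right _ h.a_pos

theorem a_le (h : P.Proper) : P.a ≤ P.b := h.b_eq ▸ Nat.le_mul_of_pos_left _ h.r_pos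

/-- The block indices as pairs of a parallel class and a label. -/
def blockEquiv (h : P.Proper) : Fin P.b ≃ Fin P.r × Fin P.a :=
  (finCongr h.b_eq).trans finProdFinEquiv.symm

theorem blockEquiv_fst (h : P.Proper) (s : Fin P.b) :
    ((h.blockEquiv s).1 : ℕ) = s / P.a := rfl

theorem blockEquiv_snd (h : P.Proper) (s : Fin P.b) :
    ((h.blockEquiv s).2 : ℕ) = s % P.a := rfl

theorem blockEquiv_symm_apply (h : P.Proper) (s : Fin P.r × Fin P.a) :
    (h.blockEquiv.symm s : ℕ) = s.1 * P.a + s.2 := by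
  simp [blockEquiv, finProdFinEquiv]
  ring

end DesignParams.Proper

/-! ### Composite machines for tuples of numbers -/

section

variable {J : Type*} {size : J → ℕ} {N₁ N₂ : Type} {nm₁ : J → N₁ → List Bool}
  {nm₂ : J → N₂ → List Bool} {v b k r a x s i β γ α κ y : J → ℕ}

/-- The chain is `s ↦ (i, β)`, then `(x, i) ↦ γ`, then `(β, γ) ↦ y`. -/
theorem polyNat_form (h₀ : PolyNat (fun _ => (Fin.elim0 : Fin 0 → List Bool))
      (fun j => ![s j, a j]) (fun j => ![i j, β j]) size)
    (h₁ : PolyNat nm₁ (fun j => ![v j, b j, k j, r j, a j, x j, i j]) (fun j => ![γ j]) size)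
    (h₂ : PolyNat nm₂ (fun j => ![a j, β j, γ j]) (fun j => ![y j]) size)
    (hv : ∀ j, Nat.log 2 (v j) ≤ size j) (hb : ∀ j, Nat.log 2 (b j) ≤ size j)
    (hk : ∀ j, Nat.log 2 (k j) ≤ size j) (hr : ∀ j, Nat.log 2 (r j) ≤ size j)
    (ha : ∀ j, Nat.log 2 (a j) ≤ size j) (hx : ∀ j, Nat.log 2 (x j) ≤ size j)
    (hs : ∀ j, Nat.log 2 (s j) ≤ size j) (hi : ∀ j, Nat.log 2 (i j) ≤ size j)
    (hβ : ∀ j, Nat.log 2 (β j) ≤ size j) (hγ : ∀ j, Nat.log 2 (γ j) ≤ size j)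
    (hy : ∀ j, Nat.log 2 (y j) ≤ size j) :
    PolyNat (fun j => Sum.elim (nm₁ j) (nm₂ j))
      (fun j => ![v j, b j, k j, r j, a j, x j, s j]) (fun j => ![y j]) size := by
  -- The vectors list where each argument is found: `.inl` refers to the inputs of the composite,
  -- `.inr` to results already computed. The value `β` is passed on for later use.
  have h₃ := h₀.comp (num := fun j => ![v j, b j, k j, r j, a j, x j, s j])
    (res := fun j => ![β j, γ j]) h₁ ![6, 4]
    ![.inl 0, .inl 1, .inl 2, .inl 3, .inl 4, .inl 5, .inr 0] ![.inr (.inl 1), .inr (.inr 0)]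
    (by intro j k; fin_cases k <;> rfl) (by intro j k; fin_cases k <;> rfl)
    (by intro j k; fin_cases k <;> rfl)
    (by intro j k; fin_cases k; exacts [hs j, ha j])
    (by intro j k; fin_cases k; exacts [hv j, hb j, hk j, hr j, ha j, hx j, hi j])
    (by intro j k; fin_cases k; exacts [hβ j, hγ j])
  have h₄ := h₃.comp (num := fun j => ![v j, b j, k j, r j, a j, x j, s j])
    (res := fun j => ![y j]) h₂ id ![.inl 4, .inr 0, .inr 1] ![.inr (.inr 0)]
    (fun j k => rfl) (by intro j k; fin_cases k <;> rfl) (by intro j k; fin_cases k; rfl)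
    (by intro j k; fin_cases k; exacts [hv j, hb j, hk j, hr j, ha j, hx j, hs j])
    (by intro j k; fin_cases k; exacts [ha j, hβ j, hγ j])
    (by intro j k; fin_cases k; exacts [hy j])
  refine PolyComp.rename h₄ (ν := Sum.map (Sum.elim Fin.elim0 id) id)
    (Sum.map_injective.2 ⟨?_, Function.injective_id⟩) ?_ (Equiv.refl _) fun j i => rfl
  · rintro (a | a) (b | b) h
    · exact a.elim0
    · exact a.elim0
    · exact b.elim0
    · exact congrArg Sum.inr h
  · rintro j ((n | n) | n)
    · exact n.elim0
    · rfl
    · rfl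

/-- The chain is `s ↦ (i, β)`, then `(β, α) ↦ γ`, then `(i, γ, κ) ↦ y`. -/
theorem polyNat_preimage (h₀ : PolyNat (fun _ => (Fin.elim0 : Fin 0 → List Bool))
      (fun j => ![s j, a j]) (fun j => ![i j, β j]) size)
    (h₁ : PolyNat nm₁ (fun j => ![v j, b j, k j, r j, a j, i j, γ j, κ j]) (fun j => ![y j]) size)
    (h₂ : PolyNat nm₂ (fun j => ![a j, β j, α j]) (fun j => ![γ j]) size)
    (hv : ∀ j, Nat.log 2 (v j) ≤ size j) (hb : ∀ j, Nat.log 2 (b j) ≤ size j)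
    (hk : ∀ j, Nat.log 2 (k j) ≤ size j) (hr : ∀ j, Nat.log 2 (r j) ≤ size j)
    (ha : ∀ j, Nat.log 2 (a j) ≤ size j) (hs : ∀ j, Nat.log 2 (s j) ≤ size j)
    (hα : ∀ j, Nat.log 2 (α j) ≤ size j) (hκ : ∀ j, Nat.log 2 (κ j) ≤ size j)
    (hi : ∀ j, Nat.log 2 (i j) ≤ size j) (hβ : ∀ j, Nat.log 2 (β j) ≤ size j)
    (hγ : ∀ j, Nat.log 2 (γ j) ≤ size j) (hy : ∀ j, Nat.log 2 (y j) ≤ size j) :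
    PolyNat (fun j => Sum.elim (nm₁ j) (nm₂ j))
      (fun j => ![v j, b j, k j, r j, a j, s j, α j, κ j]) (fun j => ![y j]) size := by
  have h₃ := h₀.comp (num := fun j => ![v j, b j, k j, r j, a j, s j, α j, κ j])
    (res := fun j => ![i j, γ j]) h₂ ![5, 4] ![.inl 4, .inr 1, .inl 6]
    ![.inr (.inl 0), .inr (.inr 0)]
    (by intro j k; fin_cases k <;> rfl) (by intro j k; fin_cases k <;> rfl)
    (by intro j k; fin_cases k <;> rfl)
    (by intro j k; fin_cases k; exacts [hs j, ha j])
    (by intro j k; fin_cases k; exacts [ha j, hβ j, hα j])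
    (by intro j k; fin_cases k; exacts [hi j, hγ j])
  have h₄ := h₃.comp (num := fun j => ![v j, b j, k j, r j, a j, s j, α j, κ j])
    (res := fun j => ![y j]) h₁ id
    ![.inl 0, .inl 1, .inl 2, .inl 3, .inl 4, .inr 0, .inr 1, .inl 7] ![.inr (.inr 0)]
    (fun j k => rfl) (by intro j k; fin_cases k <;> rfl) (by intro j k; fin_cases k; rfl)
    (by intro j k; fin_cases k; exacts [hv j, hb j, hk j, hr j, ha j, hs j, hα j, hκ j])
    (by intro j k; fin_cases k; exacts [hv j, hb j, hk j, hr j, ha j, hi j, hγ j, hκ j])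
    (by intro j k; fin_cases k; exacts [hy j])
  -- The quasigroup is called before the design, so the two descriptions have to change places.
  refine PolyComp.rename h₄ (ν := Sum.elim (Sum.elim Fin.elim0 .inr) .inl) ?_ ?_ (Equiv.refl _)
    fun j i => rfl
  · rintro ((a | a) | a) ((b | b) | b) h
    all_goals first | exact a.elim0 | exact b.elim0 | simp_all
  · rintro j ((n | n) | n)
    · exact n.elim0
    · rfl
    · rfl

/-- The chain is `(x, κ) ↦ (i, γ)`, then `(γ, α) ↦ β`, then `(i, β) ↦ s`. -/
theorem polyNat_dualPreimage
    (h₁ : PolyNat nm₁ (fun j => ![v j, b j, k j, r j, a j, x j, κ j])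
      (fun j => ![i j, γ j]) size)
    (h₂ : PolyNat nm₂ (fun j => ![a j, γ j, α j]) (fun j => ![β j]) size)
    (h₃ : PolyNat (fun _ => (Fin.elim0 : Fin 0 → List Bool))
      (fun j => ![i j, a j, β j]) (fun j => ![s j]) size)
    (hv : ∀ j, Nat.log 2 (v j) ≤ size j) (hb : ∀ j, Nat.log 2 (b j) ≤ size j)
    (hk : ∀ j, Nat.log 2 (k j) ≤ size j) (hr : ∀ j, Nat.log 2 (r j) ≤ size j)
    (ha : ∀ j, Nat.log 2 (a j) ≤ size j) (hx : ∀ j, Nat.log 2 (x j) ≤ size j)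
    (hα : ∀ j, Nat.log 2 (α j) ≤ size j) (hκ : ∀ j, Nat.log 2 (κ j) ≤ size j)
    (hi : ∀ j, Nat.log 2 (i j) ≤ size j) (hβ : ∀ j, Nat.log 2 (β j) ≤ size j)
    (hγ : ∀ j, Nat.log 2 (γ j) ≤ size j) (hs : ∀ j, Nat.log 2 (s j) ≤ size j) :
    PolyNat (fun j => Sum.elim (nm₁ j) (nm₂ j))
      (fun j => ![b j, v j, r j, k j, a j, x j, α j, κ j]) (fun j => ![s j]) size := by
  -- The composite receives the parameters of the dual; the indices `1, 0, 3, 2` undo the exchange.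
  have h₄ := h₁.comp (num := fun j => ![b j, v j, r j, k j, a j, x j, α j, κ j])
    (res := fun j => ![i j, β j]) h₂ ![1, 0, 3, 2, 4, 5, 7] ![.inl 4, .inr 1, .inl 6]
    ![.inr (.inl 0), .inr (.inr 0)]
    (by intro j k; fin_cases k <;> rfl) (by intro j k; fin_cases k <;> rfl)
    (by intro j k; fin_cases k <;> rfl)
    (by intro j k; fin_cases k; exacts [hv j, hb j, hk j, hr j, ha j, hx j, hκ j])
    (by intro j k; fin_cases k; exacts [ha j, hγ j, hα j])
    (by intro j k; fin_cases k; exacts [hi j, hβ j])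
  have h₅ := h₄.comp (num := fun j => ![b j, v j, r j, k j, a j, x j, α j, κ j])
    (res := fun j => ![s j]) h₃ id ![.inr 0, .inl 4, .inr 1] ![.inr (.inr 0)]
    (fun j k => rfl) (by intro j k; fin_cases k <;> rfl) (by intro j k; fin_cases k; rfl)
    (by intro j k; fin_cases k; exacts [hb j, hv j, hr j, hk j, ha j, hx j, hα j, hκ j])
    (by intro j k; fin_cases k; exacts [hi j, ha j, hβ j])
    (by intro j k; fin_cases k; exacts [hs j])
  refine PolyComp.rename h₅ (ν := Sum.elim id Fin.elim0) ?_ ?_ (Equiv.refl _) fun j i => rfl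
  · rintro (a | a) (b | b) h
    all_goals first | exact a.elim0 | exact b.elim0 | exact congrArg Sum.inl h
  · rintro j (n | n)
    · rfl
    · exact n.elim0

theorem PolyNat.swap_params {v b k r a x s : J → ℕ} {O : Type} {res : J → O → ℕ}
    (h : PolyNat nm₁ (fun j => ![v j, b j, k j, r j, a j, x j, s j]) res size) :
    PolyNat nm₁ (fun j => ![b j, v j, r j, k j, a j, s j, x j]) res size := by
  have hinj : (![1, 0, 3, 2, 4, 6, 5] : Fin 7 → Fin 7).Bijective := by decide
  refine PolyComp.rename h (ν := id) Function.injective_id (fun j n => rfl)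
    (Equiv.ofBijective _ hinj) fun j i => ?_
  fin_cases i <;> rfl

end

/-! ### The mosaics on integers -/

/-- The mosaic with a given functional form. -/
def Mosaic.ofFunction {X S A : Type*} (f : X → S → A) (hf : ∀ α, ∃ x s, f x s = α) :
    Mosaic X S A where
  mem α := ⟨fun x s => f x s = α⟩
  nonempty := hf
  existsUnique_inc x s := ⟨f x s, rfl, fun _ h => h.symm⟩

theorem Mosaic.functionalForm_ofFunction {X S A : Type*} (f : X → S → A)
    (hf : ∀ α, ∃ x s, f x s = α) (x : X) (s : S) :
    (Mosaic.ofFunction f hf).functionalForm x s = f x s :=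
  ((Mosaic.ofFunction f hf).functionalForm_eq_iff x s _).2 rfl

theorem Mosaic.functionalForm_dual {X S A : Type*} (M : Mosaic X S A) (s : S) (x : X) :
    M.dual.functionalForm s x = M.functionalForm x s :=
  (M.dual.functionalForm_eq_iff s x _).2 ((M.functionalForm_eq_iff x s _).1 rfl)

theorem Mosaic.Isomorphic.dual {X S A X' S' A' : Type*} {M : Mosaic X S A}
    {M' : Mosaic X' S' A'} (h : M.Isomorphic M') : M.dual.Isomorphic M'.dual := by
  obtain ⟨eX, eS, eA, h⟩ := h
  exact ⟨eS, eX, eA, fun s x α => h x s α⟩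

theorem IsQuasigroup.congr {A A' : Type*} {L : A → A → A} (hL : IsQuasigroup L) (e : A ≃ A')
    {L' : A' → A' → A'} (h : ∀ β γ, L' (e β) (e γ) = e (L β γ)) : IsQuasigroup L' := by
  have h' : ∀ β γ, L' β γ = e (L (e.symm β) (e.symm γ)) := fun β γ => by
    rw [← h, e.apply_symm_apply, e.apply_symm_apply]
  constructor
  · intro α γ
    obtain ⟨β, hβ, hu⟩ := hL.existsUnique_right (e.symm α) (e.symm γ)
    refine ⟨e β, by simp [h', hβ], fun β' hβ' => ?_⟩
    rw [← hu (e.symm β') (by simp [← hβ', h']), e.apply_symm_apply]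
  · intro β γ
    obtain ⟨α, hα, hu⟩ := hL.existsUnique_left (e.symm β) (e.symm γ)
    refine ⟨e α, by simp [h', hα], fun α' hα' => ?_⟩
    rw [← hu (e.symm α') (by simp [← hα', h']), e.apply_symm_apply]

/-- The bijection `e` is applied both to the colors and to the labels `β` in the block indices. This
is possible because design and quasigroup are explicit with respect to the same `e`. -/
theorem exists_mosaic_isomorphic {X R A : Type*} {P : DesignParams} (hP : P.Proper)
    {D : IncidenceStructure X (R × A)} (hres : D.IsResolved) (hne : D.IsNonempty)
    {L : A → A → A} (hL : IsQuasigroup L) {e : A ≃ Fin P.a}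
    {D' : IncidenceStructure (Fin P.v) (Fin P.r × Fin P.a)} (hD' : D.IsomorphicVia D' e)
    {c : Fin P.v → Fin P.r → Fin P.a} (hc : ∀ x j γ, D'.Inc x (j, γ) ↔ γ = c x j)
    {L' : Fin P.a → Fin P.a → Fin P.a} (hL' : ∀ β γ, L' (e β) (e γ) = e (L β γ)) :
    ∃ M' : Mosaic (Fin P.v) (Fin P.b) (Fin P.a),
      (Mosaic.ofResolved D hres hne L hL).Isomorphic M' ∧
      ∀ x s, M'.functionalForm x s = L' (hP.blockEquiv s).2 (c x (hP.blockEquiv s).1) := by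
  obtain ⟨eX, eR, hD'⟩ := hD'
  have key : ∀ x i β α, ((Mosaic.ofResolved D hres hne L hL).mem α).Inc x (i, β) ↔
      L' (e β) (c (eX x) (eR i)) = e α := by
    intro x i β α
    constructor
    · rintro ⟨γ, hγ, h⟩
      rw [hD', hc] at h
      rw [← h, hL', ← hγ]
    · intro h
      refine ⟨e.symm (c (eX x) (eR i)), e.injective ?_, ?_⟩
      · rw [← hL', e.apply_symm_apply, h]
      · rw [hD', hc, e.apply_symm_apply]
  refine ⟨Mosaic.ofFunction (fun x s => L' (hP.blockEquiv s).2 (c x (hP.blockEquiv s).1)) ?_,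
    ⟨eX, (eR.prodCongr e).trans hP.blockEquiv.symm, e, ?_⟩,
    fun x s => Mosaic.functionalForm_ofFunction _ _ x s⟩
  -- Every color occurs because it occurs in the original mosaic.
  · intro α
    obtain ⟨x, ⟨i, β⟩, h⟩ := (Mosaic.ofResolved D hres hne L hL).nonempty (e.symm α)
    rw [key, e.apply_symm_apply] at h
    exact ⟨eX x, hP.blockEquiv.symm (eR i, e β), by simpa using h⟩
  · rintro x ⟨i, β⟩ α
    rw [key]
    simp [Mosaic.ofFunction]

/-- The color class is a single block of `D'`: the equation `L' β γ = α` has only one solution `γ`.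
-/
theorem bijOn_preimage {P : DesignParams} (hP : P.Proper)
    {D' : IncidenceStructure (Fin P.v) (Fin P.r × Fin P.a)}
    {c : Fin P.v → Fin P.r → Fin P.a} (hc : ∀ x j γ, D'.Inc x (j, γ) ↔ γ = c x j)
    {L' sol : Fin P.a → Fin P.a → Fin P.a} (hL' : IsQuasigroup L')
    (hsol : ∀ β α, L' β (sol β α) = α) {g : Fin P.r → Fin P.a → Fin P.k → Fin P.v}
    (hg : ∀ j α, Set.BijOn (g j α) Set.univ {x | D'.Inc x (j, α)}) (s : Fin P.b) (α : Fin P.a) :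
    Set.BijOn (g (hP.blockEquiv s).1 (sol (hP.blockEquiv s).2 α)) Set.univ
      {x | L' (hP.blockEquiv s).2 (c x (hP.blockEquiv s).1) = α} := by
  convert hg (hP.blockEquiv s).1 (sol (hP.blockEquiv s).2 α) using 1
  ext x
  rw [Set.mem_ofPred_eq, Set.mem_ofPred_eq, hc]
  constructor
  · intro h
    exact (hL'.existsUnique_right _ α).unique (hsol _ _) h
  · intro h
    rw [← h, hsol]

/-- A block through `x` is determined by its class, so changing its label loses no information. In
each class the new label is the only one that gives the color `α`. -/
theorem bijOn_dualPreimage {P : DesignParams} (hP : P.Proper)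
    {D' : IncidenceStructure (Fin P.v) (Fin P.r × Fin P.a)}
    {c : Fin P.v → Fin P.r → Fin P.a} (hc : ∀ x j γ, D'.Inc x (j, γ) ↔ γ = c x j)
    {L' sol : Fin P.a → Fin P.a → Fin P.a} (hL' : IsQuasigroup L')
    (hsol : ∀ γ α, L' (sol γ α) γ = α) {g : Fin P.v → Fin P.r → Fin P.r × Fin P.a}
    (hg : ∀ x, Set.BijOn (g x) Set.univ {s | D'.Inc x s}) (x : Fin P.v) (α : Fin P.a) :
    Set.BijOn (fun κ => hP.blockEquiv.symm ((g x κ).1, sol (g x κ).2 α)) Set.univ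
      {s | L' (hP.blockEquiv s).2 (c x (hP.blockEquiv s).1) = α} := by
  have hgc : ∀ κ, (g x κ).2 = c x (g x κ).1 := fun κ => (hc _ _ _).1 ((hg x).mapsTo trivial)
  refine ⟨?_, ?_, ?_⟩
  · intro κ _
    simp [← hgc, hsol]
  · intro κ _ κ' _ h
    have h₁ : (g x κ).1 = (g x κ').1 := by
      simpa using congrArg Prod.fst (hP.blockEquiv.symm.injective h)
    exact (hg x).injOn trivial trivial (Prod.ext h₁ (by rw [hgc, hgc, h₁]))
  · intro s hs
    -- The preimage of `s` is the position of the block through `x` in the class of `s`.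
    obtain ⟨κ, -, hκ⟩ := (hg x).surjOn
      (show ((hP.blockEquiv s).1, c x (hP.blockEquiv s).1) ∈ {s | D'.Inc x s} from
        (hc _ _ _).2 rfl)
    refine ⟨κ, trivial, ?_⟩
    rw [Equiv.symm_apply_eq]
    simp only [hκ]
    exact Prod.ext rfl ((hL'.existsUnique_left _ α).unique (hsol _ _) hs)

/-! ### The machines for the mosaics -/

section

variable {ι : Type*} {P : ι → DesignParams} {dD dL : ℕ} {nameD : ι → Fin dD → List Bool}
  {nameL : ι → Fin dL → List Bool}

theorem log_le_left {n v : ℕ} (b : ℕ) (h : n ≤ v) : Nat.log 2 n ≤ Nat.log 2 v + Nat.log 2 b :=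
  (Nat.log_mono_right h).trans (Nat.le_add_right _ _)

theorem log_le_right {n b : ℕ} (v : ℕ) (h : n ≤ b) : Nat.log 2 n ≤ Nat.log 2 v + Nat.log 2 b :=
  (Nat.log_mono_right h).trans (Nat.le_add_left _ _)

theorem TableComputable.polyNat {F : ∀ i, Fin (P i).a → Fin (P i).a → Fin (P i).a}
    (hF : TableComputable (fun i => (P i).a) F nameL) {J : Type*} {size : J → ℕ} (i : J → ι)
    (β γ : ∀ j, Fin (P (i j)).a) (hs : ∀ j, Nat.log 2 (P (i j)).a ≤ size j) :
    PolyNat (fun j => nameL (i j)) (fun j => ![(P (i j)).a, β j, γ j])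
      (fun j => ![(F (i j) (β j) (γ j) : ℕ)]) size := by
  have h := ComputableInPolyTime.polyNat hF (nm := fun j => nameL j.1)
    (num := fun j => ![(P j.1).a, j.2.1, j.2.2]) (res := fun j => ![(F j.1 j.2.1 j.2.2 : ℕ)])
    (by rintro ⟨i, β, γ⟩; rfl) (by rintro ⟨i, β, γ⟩; exact bits_vec_one _)
  exact PolyComp.comap h (fun j => ⟨i j, β j, γ j⟩) (PolyBounded.self.mono hs)

theorem computable_functionalForm (hP : ∀ i, (P i).Proper)
    {c : ∀ i, Fin (P i).v → Fin (P i).r → Fin (P i).a}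
    {F : ∀ i, Fin (P i).a → Fin (P i).a → Fin (P i).a}
    (hc : ComputableInPolyTime (J := Σ i, Fin (P i).v × Fin (P i).r)
      (fun ⟨i, x, j⟩ =>
        machineInput (nameD i) ![(P i).v, (P i).b, (P i).k, (P i).r, (P i).a, x, j])
      (fun ⟨i, x, j⟩ => ![(c i x j : ℕ).bits])
      (fun ⟨i, _, _⟩ => Nat.log 2 (P i).v + Nat.log 2 (P i).r))
    (hF : TableComputable (fun i => (P i).a) F nameL) :
    PolyNat (J := Σ i, Fin (P i).v × Fin (P i).b) (fun j => Sum.elim (nameD j.1) (nameL j.1))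
      (fun j => ![(P j.1).v, (P j.1).b, (P j.1).k, (P j.1).r, (P j.1).a, j.2.1, j.2.2])
      (fun j => ![(F j.1 ((hP j.1).blockEquiv j.2.2).2
        (c j.1 j.2.1 ((hP j.1).blockEquiv j.2.2).1) : ℕ)])
      (fun j => Nat.log 2 (P j.1).v + Nat.log 2 (P j.1).b) := by
  have h₀ := polyNat_divMod (J := Σ i, Fin (P i).v × Fin (P i).b) (s := fun j => j.2.2)
    (a := fun j => (P j.1).a) (size := fun j => Nat.log 2 (P j.1).v + Nat.log 2 (P j.1).b)
    (fun j => (hP j.1).a_pos) (fun j => log_le_right _ j.2.2.2.le)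
    (fun j => log_le_right _ (hP j.1).a_le)
  simp only [← (hP _).blockEquiv_fst, ← (hP _).blockEquiv_snd] at h₀
  have h₁ := hc.polyNat (nm := fun j => nameD j.1)
    (num := fun j => ![(P j.1).v, (P j.1).b, (P j.1).k, (P j.1).r, (P j.1).a, j.2.1, j.2.2])
    (res := fun j => ![(c j.1 j.2.1 j.2.2 : ℕ)])
    (by rintro ⟨i, x, j⟩; rfl) (by rintro ⟨i, x, j⟩; exact bits_vec_one _)
  have h₁' := PolyComp.comap (J' := Σ i, Fin (P i).v × Fin (P i).b)
    (size' := fun j => Nat.log 2 (P j.1).v + Nat.log 2 (P j.1).b) h₁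
    (fun j => ⟨j.1, j.2.1, ((hP j.1).blockEquiv j.2.2).1⟩)
    -- Since `r ≤ b`, time `poly(log v, log r)` is within `poly(log v, log b)`.
    (PolyBounded.self.mono fun j => Nat.add_le_add_left (Nat.log_mono_right (hP j.1).r_le) _)
  have h₂ := hF.polyNat (J := Σ i, Fin (P i).v × Fin (P i).b)
    (size := fun j => Nat.log 2 (P j.1).v + Nat.log 2 (P j.1).b) (fun j => j.1)
    (fun j => ((hP j.1).blockEquiv j.2.2).2)
    (fun j => c j.1 j.2.1 ((hP j.1).blockEquiv j.2.2).1)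
    (fun j => log_le_right _ (hP j.1).a_le)
  exact polyNat_form h₀ h₁' h₂ (fun j => log_le_left _ le_rfl) (fun j => log_le_right _ le_rfl)
    (fun j => log_le_left _ (hP j.1).k_le) (fun j => log_le_right _ (hP j.1).r_le)
    (fun j => log_le_right _ (hP j.1).a_le) (fun j => log_le_left _ (Fin.is_le' ..))
    (fun j => log_le_right _ (Fin.is_le' ..))
    (fun j => log_le_right _ ((Fin.is_le' ..).trans (hP j.1).r_le))
    (fun j => log_le_right _ ((Fin.is_le' ..).trans (hP j.1).a_le))
    (fun j => log_le_right _ ((Fin.is_le' ..).trans (hP j.1).a_le))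
    (fun j => log_le_right _ ((Fin.is_le' ..).trans (hP j.1).a_le))

theorem computable_preimage (hP : ∀ i, (P i).Proper)
    {g : ∀ i, Fin (P i).r → Fin (P i).a → Fin (P i).k → Fin (P i).v}
    {sol : ∀ i, Fin (P i).a → Fin (P i).a → Fin (P i).a}
    (hg : ComputableInPolyTime (J := Σ i, Fin (P i).r × Fin (P i).a × Fin (P i).k)
      (fun ⟨i, j, α, κ⟩ =>
        machineInput (nameD i) ![(P i).v, (P i).b, (P i).k, (P i).r, (P i).a, j, α, κ])
      (fun ⟨i, j, α, κ⟩ => ![(g i j α κ : ℕ).bits])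
      (fun ⟨i, _, _, _⟩ => Nat.log 2 (P i).b + Nat.log 2 (P i).k))
    (hsol : TableComputable (fun i => (P i).a) sol nameL) :
    PolyNat (J := Σ i, Fin (P i).b × Fin (P i).a × Fin (P i).k)
      (fun j => Sum.elim (nameD j.1) (nameL j.1))
      (fun j => ![(P j.1).v, (P j.1).b, (P j.1).k, (P j.1).r, (P j.1).a, j.2.1, j.2.2.1, j.2.2.2])
      (fun j => ![(g j.1 ((hP j.1).blockEquiv j.2.1).1
        (sol j.1 ((hP j.1).blockEquiv j.2.1).2 j.2.2.1) j.2.2.2 : ℕ)])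
      (fun j => Nat.log 2 (P j.1).b + Nat.log 2 (P j.1).v) := by
  have h₀ := polyNat_divMod (J := Σ i, Fin (P i).b × Fin (P i).a × Fin (P i).k)
    (s := fun j => j.2.1)
    (a := fun j => (P j.1).a) (size := fun j => Nat.log 2 (P j.1).b + Nat.log 2 (P j.1).v)
    (fun j => (hP j.1).a_pos) (fun j => log_le_left _ j.2.1.2.le)
    (fun j => log_le_left _ (hP j.1).a_le)
  simp only [← (hP _).blockEquiv_fst, ← (hP _).blockEquiv_snd] at h₀
  have h₁ := hg.polyNat (nm := fun j => nameD j.1)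
    (num := fun j => ![(P j.1).v, (P j.1).b, (P j.1).k, (P j.1).r, (P j.1).a, j.2.1, j.2.2.1,
      j.2.2.2])
    (res := fun j => ![(g j.1 j.2.1 j.2.2.1 j.2.2.2 : ℕ)])
    (by rintro ⟨i, j, α, κ⟩; rfl) (by rintro ⟨i, j, α, κ⟩; exact bits_vec_one _)
  have h₁' := PolyComp.comap (J' := Σ i, Fin (P i).b × Fin (P i).a × Fin (P i).k)
    (size' := fun j => Nat.log 2 (P j.1).b + Nat.log 2 (P j.1).v) h₁
    (fun j => ⟨j.1, ((hP j.1).blockEquiv j.2.1).1,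
      sol j.1 ((hP j.1).blockEquiv j.2.1).2 j.2.2.1, j.2.2.2⟩)
    -- Since `k ≤ v`, time `poly(log b, log k)` is within `poly(log b, log v)`.
    (PolyBounded.self.mono fun j => Nat.add_le_add_left (Nat.log_mono_right (hP j.1).k_le) _)
  have h₂ := hsol.polyNat (J := Σ i, Fin (P i).b × Fin (P i).a × Fin (P i).k)
    (size := fun j => Nat.log 2 (P j.1).b + Nat.log 2 (P j.1).v) (fun j => j.1)
    (fun j => ((hP j.1).blockEquiv j.2.1).2) (fun j => j.2.2.1)
    (fun j => log_le_left _ (hP j.1).a_le)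
  exact polyNat_preimage h₀ h₁' h₂ (fun j => log_le_right _ le_rfl)
    (fun j => log_le_left _ le_rfl) (fun j => log_le_right _ (hP j.1).k_le)
    (fun j => log_le_left _ (hP j.1).r_le) (fun j => log_le_left _ (hP j.1).a_le)
    (fun j => log_le_left _ (Fin.is_le' ..))
    (fun j => log_le_left _ ((Fin.is_le' ..).trans (hP j.1).a_le))
    (fun j => log_le_right _ ((Fin.is_le' ..).trans (hP j.1).k_le))
    (fun j => log_le_left _ ((Fin.is_le' ..).trans (hP j.1).r_le))
    (fun j => log_le_left _ ((Fin.is_le' ..).trans (hP j.1).a_le))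
    (fun j => log_le_left _ ((Fin.is_le' ..).trans (hP j.1).a_le))
    (fun j => log_le_right _ (Fin.is_le' ..))

theorem computable_dualPreimage (hP : ∀ i, (P i).Proper)
    {g : ∀ i, Fin (P i).v → Fin (P i).r → Fin (P i).r × Fin (P i).a}
    {sol : ∀ i, Fin (P i).a → Fin (P i).a → Fin (P i).a}
    (hg : ComputableInPolyTime (J := Σ i, Fin (P i).v × Fin (P i).r)
      (fun ⟨i, x, κ⟩ =>
        machineInput (nameD i) ![(P i).v, (P i).b, (P i).k, (P i).r, (P i).a, x, κ])
      (fun ⟨i, x, κ⟩ => ![((g i x κ).1 : ℕ).bits, ((g i x κ).2 : ℕ).bits])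
      (fun ⟨i, _, _⟩ => Nat.log 2 (P i).b + Nat.log 2 (P i).k))
    (hsol : TableComputable (fun i => (P i).a) sol nameL) :
    PolyNat (J := Σ i, Fin (P i).v × Fin (P i).a × Fin (P i).r)
      (fun j => Sum.elim (nameD j.1) (nameL j.1))
      (fun j => ![(P j.1).b, (P j.1).v, (P j.1).r, (P j.1).k, (P j.1).a, j.2.1, j.2.2.1, j.2.2.2])
      (fun j => ![((hP j.1).blockEquiv.symm ((g j.1 j.2.1 j.2.2.2).1,
        sol j.1 (g j.1 j.2.1 j.2.2.2).2 j.2.2.1) : ℕ)])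
      (fun j => Nat.log 2 (P j.1).v + Nat.log 2 (P j.1).b) := by
  have h₁ := hg.polyNat (nm := fun j => nameD j.1)
    (num := fun j => ![(P j.1).v, (P j.1).b, (P j.1).k, (P j.1).r, (P j.1).a, j.2.1, j.2.2])
    (res := fun j => ![((g j.1 j.2.1 j.2.2).1 : ℕ), ((g j.1 j.2.1 j.2.2).2 : ℕ)])
    (by rintro ⟨i, x, κ⟩; rfl) (by rintro ⟨i, x, κ⟩; exact bits_vec_two _ _)
  have h₁' := PolyComp.comap (J' := Σ i, Fin (P i).v × Fin (P i).a × Fin (P i).r)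
    (size' := fun j => Nat.log 2 (P j.1).v + Nat.log 2 (P j.1).b) h₁
    (fun j => ⟨j.1, j.2.1, j.2.2.2⟩)
    (PolyBounded.self.mono fun j => (add_comm _ _).trans_le
      (Nat.add_le_add_right (Nat.log_mono_right (hP j.1).k_le) _))
  have h₂ := hsol.polyNat (J := Σ i, Fin (P i).v × Fin (P i).a × Fin (P i).r)
    (size := fun j => Nat.log 2 (P j.1).v + Nat.log 2 (P j.1).b) (fun j => j.1)
    (fun j => (g j.1 j.2.1 j.2.2.2).2) (fun j => j.2.2.1)
    (fun j => log_le_right _ (hP j.1).a_le)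
  have h₃ := polyNat_mulAdd (J := Σ i, Fin (P i).v × Fin (P i).a × Fin (P i).r)
    (x := fun j => (g j.1 j.2.1 j.2.2.2).1) (a := fun j => (P j.1).a)
    (y := fun j => sol j.1 (g j.1 j.2.1 j.2.2.2).2 j.2.2.1)
    (size := fun j => Nat.log 2 (P j.1).v + Nat.log 2 (P j.1).b) (fun j => Fin.is_lt _)
    (fun j => log_le_right _ ((Fin.is_le' ..).trans (hP j.1).r_le))
    (fun j => log_le_right _ (hP j.1).a_le)
  have hsymm : ∀ j : Σ i, Fin (P i).v × Fin (P i).a × Fin (P i).r,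
      ((g j.1 j.2.1 j.2.2.2).1 : ℕ) * (P j.1).a + sol j.1 (g j.1 j.2.1 j.2.2.2).2 j.2.2.1 =
      ((hP j.1).blockEquiv.symm ((g j.1 j.2.1 j.2.2.2).1,
        sol j.1 (g j.1 j.2.1 j.2.2.2).2 j.2.2.1) : ℕ) := fun j => by
    rw [(hP j.1).blockEquiv_symm_apply]
  simp only [hsymm] at h₃
  exact polyNat_dualPreimage h₁' h₂ h₃ (fun j => log_le_left _ le_rfl)
    (fun j => log_le_right _ le_rfl) (fun j => log_le_left _ (hP j.1).k_le)
    (fun j => log_le_right _ (hP j.1).r_le) (fun j => log_le_right _ (hP j.1).a_le)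
    (fun j => log_le_left _ (Fin.is_le' ..))
    (fun j => log_le_right _ ((Fin.is_le' ..).trans (hP j.1).a_le))
    (fun j => log_le_right _ ((Fin.is_le' ..).trans (hP j.1).r_le))
    (fun j => log_le_right _ ((Fin.is_le' ..).trans (hP j.1).r_le))
    (fun j => log_le_right _ ((Fin.is_le' ..).trans (hP j.1).a_le))
    (fun j => log_le_right _ ((Fin.is_le' ..).trans (hP j.1).a_le))
    (fun j => log_le_right _ (Fin.is_le' ..))

end

theorem mainTheorem10 {ι : Type*} {X R A : ι → Type*}
    [∀ i, Finite (X i)] [∀ i, Finite (R i)] [∀ i, Finite (A i)]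
    (P : ι → DesignParams)
    (D : ∀ i, IncidenceStructure (X i) (R i × A i))
    (hD : ∀ i, (D i).IsResolvableConfig (P i))
    (L : ∀ i, A i → A i → A i) (hL : ∀ i, IsQuasigroup (L i))
    (e : ∀ i, A i ≃ Fin (P i).a)
    {dD dL : ℕ} (nameD : ι → Fin dD → List Bool) (nameL : ι → Fin dL → List Bool) :
    (IncidenceStructure.ExplicitFamily D P e nameD →
      QuasigroupExplicitFamily L (fun i => (P i).a) e nameL →
      Mosaic.ExplicitFamily
        (fun i => Mosaic.ofResolved (D i) (hD i).resolved (hD i).nonempty (L i) (hL i))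
        P (fun i => Fin.append (nameD i) (nameL i))) ∧
    (IncidenceStructure.DualExplicitFamily D P e nameD →
      QuasigroupDualExplicitFamily L (fun i => (P i).a) e nameL →
      Mosaic.ExplicitFamily
        (fun i => (Mosaic.ofResolved (D i) (hD i).resolved (hD i).nonempty (L i) (hL i)).dual)
        (fun i => (P i).dual) (fun i => Fin.append (nameD i) (nameL i))) := by
  have hP : ∀ i, (P i).Proper := fun i => (hD i).proper
  constructor
  · rintro ⟨D', hD', ⟨c, hc, hcT⟩, g, hg, hgT⟩ ⟨L', hL', hLT, sol, hsol, hsolT⟩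
    choose M' hM' hform using fun i => exists_mosaic_isomorphic (hP i) (hD i).resolved
      (hD i).nonempty (hL i) (hD' i) (hc i) (hL' i)
    refine ⟨M', hM', ?_, fun i s α κ => g i ((hP i).blockEquiv s).1
      (sol i ((hP i).blockEquiv s).2 α) κ, fun i s α => ?_, ?_⟩
    · refine (computable_functionalForm hP hcT hLT).computableInPolyTime ?_ ?_
      · rintro ⟨i, x, s⟩
        rfl
      · rintro ⟨i, x, s⟩
        simp only [hform]
        exact bits_vec_one _
    · simp only [hform]
      exact bijOn_preimage (hP i) (hc i) ((hL i).congr (e i) (hL' i)) (hsol i) (hg i) s α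
    · refine (computable_preimage hP hgT hsolT).computableInPolyTime ?_ ?_
      · rintro ⟨i, s, α, κ⟩
        rfl
      · rintro ⟨i, s, α, κ⟩
        exact bits_vec_one _
  · rintro ⟨D', hD', ⟨c, hc, hcT⟩, g, hg, hgT⟩ ⟨L', hL', hLT, sol, hsol, hsolT⟩
    choose M' hM' hform using fun i => exists_mosaic_isomorphic (hP i) (hD i).resolved
      (hD i).nonempty (hL i) (hD' i) (hc i) (hL' i)
    have hdual : ∀ i s x, (M' i).dual.functionalForm s x =
        L' i ((hP i).blockEquiv s).2 (c i x ((hP i).blockEquiv s).1) := fun i s x => by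
      rw [Mosaic.functionalForm_dual, hform]
    have hbij : ∀ i (x : Fin (P i).v) (α : Fin (P i).a),
        Set.BijOn (fun κ => (hP i).blockEquiv.symm ((g i x κ).1, sol i (g i x κ).2 α)) Set.univ
          {s | (M' i).dual.functionalForm s x = α} := fun i x α => by
      simp only [hdual]
      exact bijOn_dualPreimage (hP i) (hc i) ((hL i).congr (e i) (hL' i)) (hsol i) (hg i) x α
    refine ⟨fun i => (M' i).dual, fun i => (hM' i).dual, ?_, fun i x α κ =>
      (hP i).blockEquiv.symm ((g i x κ).1, sol i (g i x κ).2 α), fun i x α => ?_, ?_⟩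
    -- The dual has the same functional form with exchanged arguments; the machine for `M` only
    -- needs its input stacks permuted.
    · have h := (computable_functionalForm hP hcT hLT).swap_params
      have h' := PolyComp.comap (J' := Σ i, Fin (P i).b × Fin (P i).v)
        (size' := fun j => Nat.log 2 (P j.1).b + Nat.log 2 (P j.1).v) h
        (fun j => ⟨j.1, j.2.2, j.2.1⟩) (PolyBounded.self.mono fun j => (add_comm _ _).le)
      refine PolyNat.computableInPolyTime h' ?_ ?_
      · rintro ⟨i, s, x⟩
        rfl
      · rintro ⟨i, s, x⟩
        exact (congrArg (fun n : Fin (P i).a => ![(n : ℕ).bits]) (hdual i s x)).trans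
          (bits_vec_one _)
    · exact hbij i x α
    · refine (computable_dualPreimage hP hgT hsolT).computableInPolyTime ?_ ?_
      · rintro ⟨i, x, α, κ⟩
        rfl
      · rintro ⟨i, x, α, κ⟩
        exact bits_vec_one _
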